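/- **Theorem 1.10.** All graphs are finite, and all families $\mathcal{F}$ of graphs are such that every graph in $\mathcal{F}$ has at least one edge. A graph is $\mathcal{F}$-free if it contains no member of $\mathcal{F}$ as a (not necessarily induced) subgraph. Let $\mathrm{ex}(n,\mathcal{F})$ denote the maximum number of edges, and $\mathrm{ex}(n,H,\mathcal{F})$ the maximum number of copies of $H$ (subgraphs isomorphic to $H$), in an $n$-vertex $\mathcal{F}$-free graph. Let $P_t$ be the path on $t$ vertices. For a graph $H$, a set $R\subseteq V(H)$ and an integer $q\ge 1$, let $H_R^q$ be the union of $q$ copies of $H$ which agree on $R$ and are otherwise disjoint, and for $k\ge 1$ let $$\mathcal{F}_{H,k}^q=\{H_R^q : R\subsetneq V(H),\ H-R \text{ has at least } k \text{ connected components}\}.$$ Let $k,t\ge 3$ be integers with $t\not\equiv 2 \pmod{k-1}$, and let $\mathcal{F}$ be a family of graphs. 1. If there exists an integer $q\ge 1$ such that every $\mathcal{F}$-free graph is $\mathcal{F}_{P_t,k+1}^q$-free, then $$\mathrm{ex}(n,P_t,\mathcal{F})=O_{t,k,q}\big(\mathrm{ex}(n,\mathcal{F})^{k-1}\cdot n\big),$$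 that is, $\mathrm{ex}(n,P_t,\mathcal{F})\le C\,\mathrm{ex}(n,\mathcal{F})^{k-1}n$ for all $n\ge 0$, with a constant $C>0$ depending only on $t,k,q$. 2. If no such $q$ exists, then $$\mathrm{ex}(n,P_t,\mathcal{F})=\Omega_{t,k}(n^{k+1}),$$ that is, $\mathrm{ex}(n,P_t,\mathcal{F})\ge c\,n^{k+1}$ for all $n\ge N$, with constants $c>0$ and $N$ depending only on $t,k$. -/

import Mathlib

namespace GenTuran

/-- A family of finite graphs, each represented up to isomorphism on a vertex set `Fin m`. -/
abbrev GraphFamily : Type := Set (Σ m : ℕ, SimpleGraph (Fin m))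

/-- `G` is `ℱ`-free: no member of `ℱ` is isomorphic to a (not necessarily induced) subgraph
of `G`. -/
def IsFree (ℱ : GraphFamily) {V : Type*} (G : SimpleGraph V) : Prop :=
  ∀ F ∈ ℱ, F.2.Free G

open Classical in
/-- The Turán number `ex(n, ℱ)`: the maximum number of edges of an `n`-vertex `ℱ`-free graph. -/
noncomputable def turanNumber (n : ℕ) (ℱ : GraphFamily) : ℕ :=
  (Finset.univ.filter fun G : SimpleGraph (Fin n) => IsFree ℱ G).sup fun G => G.edgeFinset.card

open Classical in
/-- The generalized Turán number `ex(n, H, ℱ)`: the maximum number of (unlabelled) copies of `H`,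
i.e. subgraphs isomorphic to `H`, in an `n`-vertex `ℱ`-free graph. -/
noncomputable def genTuranNumber (n : ℕ) {W : Type*} (H : SimpleGraph W) (ℱ : GraphFamily) : ℕ :=
  (Finset.univ.filter fun G : SimpleGraph (Fin n) => IsFree ℱ G).sup fun G => G.copyCount H

/-- The vertices of `H_R^q`: one shared copy of `R`, and `q` disjoint copies of `V(H) \ R`. -/
abbrev FlowerVertex {V : Type*} (R : Set V) (q : ℕ) : Type _ :=
  {x : V // x ∈ R} ⊕ ({x : V // x ∉ R} × Fin q)

open Classical in
/-- The vertex map of the `p`-th copy of `H` in `H_R^q`. -/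
noncomputable def flowerCopy {V : Type*} (R : Set V) (q : ℕ) (p : Fin q) (x : V) :
    FlowerVertex R q :=
  if h : x ∈ R then Sum.inl ⟨x, h⟩ else Sum.inr (⟨x, h⟩, p)

/-- The graph `H_R^q` (for `q ≥ 1`): the union of `q` copies of `H` which agree on the vertex
set `R` and are otherwise disjoint. -/
noncomputable def flowerPower {V : Type*} (H : SimpleGraph V) (R : Set V) (q : ℕ) :
    SimpleGraph (FlowerVertex R q) :=
  ⨆ p : Fin q, H.map (flowerCopy R q p)

/-- The family of all graphs `H_R^q` where `R` is a proper subset of the vertex set of `H` such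
that `H - R` has at least `k` connected components. -/
def flowerFamily {V : Type*} [Finite V] (H : SimpleGraph V) (k q : ℕ) : GraphFamily :=
  {X | ∃ R : Set V, R ≠ Set.univ ∧ k ≤ Nat.card (H.induce Rᶜ).ConnectedComponent ∧
    Nonempty (X.2 ≃g flowerPower H R q)}

/-- Every finite `ℱ`-free graph is `𝒢`-free. -/
def FreeImpliesFree (ℱ 𝒢 : GraphFamily) : Prop :=
  ∀ (m : ℕ) (G : SimpleGraph (Fin m)), IsFree ℱ G → IsFree 𝒢 G

end GenTuran

namespace GenTuran

/-! Upper bound. For a family of labelled paths, a set of positions is stable if every member can be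
altered within the family on exactly these positions, avoiding any bounded set of vertices. Altering
one path repeatedly and disjointly produces a flower of `P_t` whose petals live on the variable
positions. So in a graph without the forbidden flowers, no stable set, and no flexible template
assembled from pieces of several paths, can have `k + 1` variable segments separated by fixed
positions (`not_flexible_of_isFree`).

A delta-system argument (`exists_homogeneous_subfamily`) keeps a positive proportion of the labelled
paths, such that a set of positions determines the path unless it misses some nonempty stable set.
Hence it suffices to meet all stable sets by `k - 1` edges and one vertex of `P_t`: the paths then
number `O(e(G) ^ (k - 1) * n)`. Stable sets are closed under union, and a greedy choice meets them
all by at most `k` edges (`exists_edge_transversal`). If `k - 1` edges and a vertex never suffice,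
each of the `2k` ends of these edges lies in a stable set that contains none of the others
(`exists_transversal_or_pinned`).

In that case paths can be recombined into a flexible template with `k + 1` segments, a contradiction
(`exists_flexible_of_pinned`). The congruence condition enters here. The `k - 1` gaps between
consecutive edges add up to at most `t - 2`, so some gap is strictly less than `(t - 2) / (k - 1)`.
Either a free path can be put in front of a template that already has `k` segments, or there are
flexible links no longer than this gap that can be chained; the strict inequality leaves room for a
nonempty free prefix before the chain.

Lower bound. If no `q` works, `ℱ`-free graphs contain arbitrarily large flowers with at least `k +
1` components outside the kernel. Choosing a petal independently for each component gives at least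
`q ^ (k + 1)` copies of `P_t` (`pow_le_copyCount`), and an induced subgraph on exactly `n` vertices
accommodates `n / t` petals. -/

/-- The values of `f` on `[0, n)` form a path of `G`, in this order. -/
def IsPathOn {V : Type*} (G : SimpleGraph V) (n : ℕ) (f : ℕ → V) : Prop :=
  Set.InjOn f (Set.Iio n) ∧ ∀ i, i + 1 < n → G.Adj (f i) (f (i + 1))

/-- For every set `B` of at most `N` vertices, `P` has a member that agrees with `g` on the
positions in `[0, t) \ W` and avoids `B` on the positions in `[0, t) ∩ W`. -/
def Flexible {V : Type*} (P : Set (ℕ → V)) (t N : ℕ) (g : ℕ → V) (W : Set ℕ) : Prop :=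
  ∀ B : Finset V, B.card ≤ N →
    ∃ f ∈ P, (∀ i < t, i ∉ W → f i = g i) ∧ ∀ i < t, i ∈ W → f i ∉ B

/-- Every member of `P` can be perturbed inside `P` on exactly the positions of `W`. -/
def Stable {V : Type*} (P : Set (ℕ → V)) (t N : ℕ) (W : Set ℕ) : Prop :=
  ∀ f ∈ P, Flexible P t N f W

/-- `W ∩ [0, t)` meets at least `k + 1` intervals that are separated by elements outside `W`. -/
def Alternates (k : ℕ) (W : Set ℕ) (t : ℕ) : Prop :=
  ∃ w s : ℕ → ℕ, (∀ i ≤ k, w i ∈ W) ∧ (∀ i < k, w i < s i ∧ s i < w (i + 1) ∧ s i ∉ W) ∧ w k < t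

/-- `x` and `y` are joined by paths with `d` edges whose interiors avoid any given `M` vertices. -/
def Linked {V : Type*} (G : SimpleGraph V) (M d : ℕ) (x y : V) : Prop :=
  ∀ B : Finset V, B.card ≤ M →
    ∃ f, IsPathOn G (d + 1) f ∧ f 0 = x ∧ f d = y ∧ ∀ i, 0 < i → i < d → f i ∉ B

/-! ### Building path templates: unions, free prefixes, links and chains. -/

section Flexible

variable {V : Type*} {G : SimpleGraph V}

lemma Stable.union {P : Set (ℕ → V)} {t N : ℕ} {U U' : Set ℕ} (h : Stable P t N U)
    (h' : Stable P t N U') : Stable P t N (U ∪ U') := by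
  intro f hf B hB
  obtain ⟨f₁, hf₁, h₁, h₁'⟩ := h f hf B hB
  obtain ⟨f₂, hf₂, h₂, h₂'⟩ := h' f₁ hf₁ B hB
  refine ⟨f₂, hf₂, fun i hi hiU => ?_, fun i hi hiU => ?_⟩
  · rw [Set.mem_union, not_or] at hiU
    rw [h₂ i hi hiU.2, h₁ i hi hiU.1]
  · by_cases hU' : i ∈ U'
    · exact h₂' i hi hU'
    · rw [h₂ i hi hU']
      exact h₁' i hi (hiU.resolve_right hU')

lemma Stable.empty (P : Set (ℕ → V)) (t N : ℕ) : Stable P t N ∅ :=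
  fun f hf _ _ => ⟨f, hf, fun _ _ _ => rfl, fun _ _ h => h.elim⟩

lemma Stable.biUnion {P : Set (ℕ → V)} {t N : ℕ} {Z : ℕ → Set ℕ} (n : ℕ)
    (h : ∀ i < n, Stable P t N (Z i)) : Stable P t N {x | ∃ i < n, x ∈ Z i} := by
  induction n with
  | zero => simpa using Stable.empty P t N
  | succ n ih =>
    have := (ih fun i hi => h i (by omega)).union (h n (by omega))
    convert this using 1
    ext x
    simp only [Set.mem_ofPred_eq, Set.mem_union, Nat.lt_succ_iff_lt_or_eq]
    constructor
    · rintro ⟨i, hi | rfl, hx⟩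
      · exact Or.inl ⟨i, hi, hx⟩
      · exact Or.inr hx
    · rintro (⟨i, hi, hx⟩ | hx)
      · exact ⟨i, Or.inl hi, hx⟩
      · exact ⟨n, Or.inr rfl, hx⟩

lemma Flexible.mono {P Q : Set (ℕ → V)} {t t' N N' : ℕ} {g : ℕ → V} {W : Set ℕ}
    (h : Flexible P t N g W) (hPQ : P ⊆ Q) (ht : t' ≤ t) (hN : N' ≤ N) :
    Flexible Q t' N' g W := by
  intro B hB
  obtain ⟨f, hf, h₁, h₂⟩ := h B (hB.trans hN)
  exact ⟨f, hPQ hf, fun i hi => h₁ i (by omega), fun i hi => h₂ i (by omega)⟩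

lemma IsPathOn.mono {n m : ℕ} {f : ℕ → V} (h : IsPathOn G n f) (hm : m ≤ n) : IsPathOn G m f :=
  ⟨h.1.mono fun i (hi : i < m) => lt_of_lt_of_le hi hm, fun i hi => h.2 i (by omega)⟩

lemma IsPathOn.shift {n a m : ℕ} {f : ℕ → V} (h : IsPathOn G n f) (hm : a + m ≤ n) :
    IsPathOn G m fun i => f (a + i) := by
  refine ⟨fun i (hi : i < m) j (hj : j < m) hij => ?_, fun i hi => h.2 (a + i) (by omega)⟩
  have := h.1 (show a + i < n by omega) (show a + j < n by omega) hij
  omega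

lemma IsPathOn.reverse {n : ℕ} {f : ℕ → V} (h : IsPathOn G n f) :
    IsPathOn G n fun i => f (n - 1 - i) := by
  refine ⟨fun i (hi : i < n) j (hj : j < n) hij => ?_, fun i hi => ?_⟩
  · have := h.1 (show n - 1 - i < n by omega) (show n - 1 - j < n by omega) hij
    omega
  · have := h.2 (n - 1 - (i + 1)) (by omega)
    rw [show n - 1 - (i + 1) + 1 = n - 1 - i by omega] at this
    exact this.symm

lemma IsPathOn.append {n m : ℕ} {f g : ℕ → V} (hf : IsPathOn G n f) (hg : IsPathOn G m g)
    (hfg : ∀ i < n, ∀ j < m, f i ≠ g j) (hadj : 0 < n → 0 < m → G.Adj (f (n - 1)) (g 0)) :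
    IsPathOn G (n + m) fun i => if i < n then f i else g (i - n) := by
  refine ⟨fun i (hi : i < n + m) j (hj : j < n + m) hij => ?_, fun i hi => ?_⟩
  · dsimp only at hij
    split_ifs at hij with h₁ h₂ h₂
    · exact hf.1 h₁ h₂ hij
    · exact absurd hij (hfg i h₁ _ (by omega))
    · exact absurd hij.symm (hfg j h₂ _ (by omega))
    · have := hg.1 (show i - n < m by omega) (show j - n < m by omega) hij
      omega
  · dsimp only
    rcases lt_trichotomy (i + 1) n with h | h | h
    · rw [if_pos (by omega), if_pos h]
      exact hf.2 i h
    · rw [if_pos (by omega), if_neg (by omega), show i + 1 - n = 0 by omega,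
        show i = n - 1 by omega]
      exact hadj (by omega) (by omega)
    · rw [if_neg (by omega), if_neg (by omega), show i + 1 - n = i - n + 1 by omega]
      exact hg.2 _ (by omega)

lemma Linked.symm {M d : ℕ} {x y : V} (h : Linked G M d x y) : Linked G M d y x := by
  intro B hB
  obtain ⟨f, hf, hx, hy, hfB⟩ := h B hB
  exact ⟨_, hf.reverse, by simpa using hy, by simpa using hx,
    fun i h₀ h₁ => hfB _ (by omega) (by omega)⟩

/-- Greedy construction of a path that avoids given vertices. -/
lemma exists_isPathOn_avoiding {Z : V → Prop} {M : ℕ}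
    (hZ : ∀ x, Z x → ∀ F : Finset V, F.card ≤ M → ∃ y ∉ F, Z y ∧ G.Adj x y) (L : ℕ) :
    ∀ x, Z x → ∀ F : Finset V, F.card + L ≤ M + 1 →
      ∃ z, IsPathOn G L z ∧ (∀ i < L, z i ∉ F) ∧ (0 < L → G.Adj x (z 0)) := by
  classical
  induction L with
  | zero =>
    intro x _ F _
    exact ⟨fun _ => x, ⟨fun i hi => absurd hi (Nat.not_lt_zero i), fun i hi => by omega⟩,
      fun i hi => by omega, fun h => by omega⟩
  | succ L ih =>
    intro x hx F hF
    obtain ⟨y, hyF, hy, hxy⟩ := hZ x hx F (by omega)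
    obtain ⟨z, hz, hzF, hyz⟩ := ih y hy (insert y F) (by
      have := Finset.card_insert_le y F
      omega)
    have h1 : IsPathOn G 1 fun _ => y :=
      ⟨fun i (hi : i < 1) j (hj : j < 1) _ => by omega, fun i hi => by omega⟩
    have := h1.append hz (fun i _ j hj h => hzF j hj (h ▸ Finset.mem_insert_self _ _))
      (fun _ h => hyz h)
    refine ⟨_, by rwa [Nat.add_comm] at this, fun i hi => ?_, fun _ => by simpa using hxy⟩
    split_ifs with h
    · exact hyF
    · exact fun hmem => hzF (i - 1) (by omega) (Finset.mem_insert_of_mem hmem)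

/-- Position `0` is fixed, so every alteration starts at the same vertex `g 0`. The free path is
grown greedily from there after the alteration is known, avoiding it, and is then reversed. -/
lemma Flexible.prefix {Z : V → Prop} {M n N L : ℕ} {g : ℕ → V} {W : Set ℕ}
    (hZ : ∀ x, Z x → ∀ F : Finset V, F.card ≤ M → ∃ y ∉ F, Z y ∧ G.Adj x y)
    (h : Flexible {f | IsPathOn G n f} n N g W) (hn : 0 < n) (h0 : 0 ∉ W) (hg : Z (g 0))
    (hM : N + n + L ≤ M + 1) :
    Flexible {f | IsPathOn G (L + n) f} (L + n) N (fun i => g (i - L))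
      {i | i < L ∨ i - L ∈ W} := by
  classical
  intro B hB
  obtain ⟨f, hf, hfg, hfB⟩ := h B hB
  have hf0 : f 0 = g 0 := hfg 0 hn h0
  obtain ⟨z, hz, hzF, hyz⟩ := exists_isPathOn_avoiding hZ L (g 0) hg
    (B ∪ (Finset.range n).image f) (by
      have h₁ := Finset.card_union_le B ((Finset.range n).image f)
      have h₂ := Finset.card_image_le (s := Finset.range n) (f := f)
      rw [Finset.card_range] at h₂
      omega)
  refine ⟨_, hz.reverse.append hf (fun i hi j hj hij => ?_) (fun h₀ _ => ?_),
    fun i hi hiW => ?_, fun i hi hiW => ?_⟩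
  · apply hzF (L - 1 - i) (by omega)
    rw [hij]
    exact Finset.mem_union_right _ (Finset.mem_image_of_mem _ (Finset.mem_range.2 hj))
  · rw [hf0, Nat.sub_self]
    exact (hyz h₀).symm
  · simp only [Set.mem_ofPred_eq, not_or] at hiW
    rw [if_neg hiW.1]
    exact hfg _ (by omega) hiW.2
  · simp only [Set.mem_ofPred_eq] at hiW
    split_ifs with hL
    · exact fun hmem => hzF _ (by omega) (Finset.mem_union_left _ hmem)
    · exact hfB _ (by omega) (hiW.resolve_left hL)

/-- The old part is altered first and made to avoid `y`, which costs one unit of `N`. The link is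
chosen afterwards, avoiding the altered part. -/
lemma Flexible.append {M n N d : ℕ} {g : ℕ → V} {W : Set ℕ} {y : V} (hd : 0 < d)
    (h : Flexible {f | IsPathOn G (n + 1) f} (n + 1) (N + 1) g W) (hn : n ∉ W)
    (hl : Linked G M d (g n) y) (hM : N + (n + 1) ≤ M) (hy : ∀ i ≤ n, g i ≠ y)
    (hW : ∀ i, n < i → i < n + d → i ∈ W) (hnd : n + d ∉ W) :
    Flexible {f | IsPathOn G (n + d + 1) f} (n + d + 1) N
      (fun i => if i ≤ n then g i else y) W := by
  classical
  intro B hB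
  obtain ⟨f, hf, hfg, hfB⟩ := h (insert y B) (by
    have := Finset.card_insert_le y B
    omega)
  obtain ⟨z, hz, hz0, hzd, hzF⟩ := hl (B ∪ (Finset.range (n + 1)).image f) (by
      have h₁ := Finset.card_union_le B ((Finset.range (n + 1)).image f)
      have h₂ := Finset.card_image_le (s := Finset.range (n + 1)) (f := f)
      rw [Finset.card_range] at h₂
      omega)
  have hfn : f n = g n := hfg n (by omega) hn
  have key := hf.append (hz.shift (a := 1) (m := d) (by omega)) (fun i hi j hj hij => ?_)
    (fun _ _ => ?_)
  · refine ⟨_, by rwa [show n + d + 1 = n + 1 + d by omega], fun i hi hiW => ?_,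
      fun i hi hiW => ?_⟩
    · by_cases h₁ : i < n + 1
      · simpa [h₁, Nat.lt_succ_iff.1 h₁] using hfg i h₁ hiW
      · have : ¬ i < n + d := fun hlt => hiW (hW i (by omega) hlt)
        dsimp only
        rw [if_neg h₁, if_neg (by omega), show 1 + (i - (n + 1)) = d by omega, hzd]
    · split_ifs with h₁
      · exact fun hmem => hfB i h₁ hiW (Finset.mem_insert_of_mem hmem)
      · have : i ≠ n + d := fun h => hnd (h ▸ hiW)
        exact fun hmem => hzF _ (by omega) (by omega) (Finset.mem_union_left _ hmem)
  · rcases Nat.lt_or_ge (1 + j) d with h₁ | h₁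
    · apply hzF (1 + j) (by omega) h₁
      rw [← hij]
      exact Finset.mem_union_right _ (Finset.mem_image_of_mem _ (Finset.mem_range.2 hi))
    · rw [show 1 + j = d by omega, hzd] at hij
      by_cases hiW : i ∈ W
      · exact hfB i hi hiW (hij ▸ Finset.mem_insert_self _ _)
      · exact hy i (by omega) ((hfg i hi hiW).symm.trans hij)
  · have := hz.2 0 (by omega)
    rw [hz0] at this
    simpa [hfn] using this

/-- A chain of `j` links, started by a free path on `L` vertices. -/
lemma exists_flexible_chain {Z Hub : V → Prop} {M L d : ℕ} {x₀ : V} (hd : 0 < d)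
    (hZ : ∀ x, Z x → ∀ F : Finset V, F.card ≤ M → ∃ y ∉ F, Z y ∧ G.Adj x y)
    (hHub : ∀ x, Hub x → ∀ F : Finset V, F.card ≤ M → ∃ y ∉ F, Hub y ∧ Linked G M d x y)
    (hx₀ : Z x₀) (hx₀' : Hub x₀) (j : ℕ) (hj : L + j * d + 1 ≤ M) :
    ∃ g : ℕ → V, Hub (g (L + j * d)) ∧ ∀ N, N + (L + j * d + 1) ≤ M →
      Flexible {f | IsPathOn G (L + j * d + 1) f} (L + j * d + 1) N g
        {i | i < L ∨ ¬ d ∣ i - L} := by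
  classical
  induction j with
  | zero =>
    refine ⟨fun _ => x₀, hx₀', fun N hN => ?_⟩
    have h1 : Flexible {f | IsPathOn G 1 f} 1 N (fun _ => x₀) {i | ¬ d ∣ i} := by
      refine fun B _ => ⟨fun _ => x₀, ⟨fun i (hi : i < 1) j (hj : j < 1) _ => by omega,
        fun i hi => by omega⟩, fun _ _ _ => rfl, fun i hi hiW => ?_⟩
      obtain rfl : i = 0 := by omega
      exact absurd (dvd_zero d) hiW
    have := h1.prefix (L := L) hZ Nat.one_pos (by simp) hx₀ (by omega)
    simpa using this
  | succ j ih =>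
    have e : (j + 1) * d = j * d + d := by ring
    obtain ⟨g, hg, hflex⟩ := ih (by omega)
    obtain ⟨y, hyF, hy, hl⟩ := hHub _ hg ((Finset.range (L + j * d + 1)).image g) (by
      have h₂ := Finset.card_image_le (s := Finset.range (L + j * d + 1)) (f := g)
      rw [Finset.card_range] at h₂
      omega)
    rw [e, ← Nat.add_assoc]
    refine ⟨fun i => if i ≤ L + j * d then g i else y, ?_, fun N hN => ?_⟩
    · dsimp only
      rwa [if_neg (by omega)]
    · refine (hflex (N + 1) (by omega)).append hd ?_ hl (by omega) (fun i hi h => hyF ?_) ?_ ?_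
      · simp
      · rw [← h]
        exact Finset.mem_image_of_mem _ (Finset.mem_range.2 (by omega))
      · intro i h₁ h₂
        refine Or.inr fun hdvd => ?_
        obtain ⟨c, hc⟩ := hdvd
        have h₃ : d * j < d * c := by
          rw [Nat.mul_comm d j]
          omega
        have h₄ : d * c < d * (j + 1) := by
          rw [Nat.mul_comm d (j + 1), e]
          omega
        have := Nat.lt_of_mul_lt_mul_left h₃
        have := Nat.lt_of_mul_lt_mul_left h₄
        omega
      · have h : L + j * d + d - L = (j + 1) * d := by
          rw [e]
          omega
        simp only [Set.mem_ofPred_eq, h, dvd_mul_left, not_true_eq_false, or_false]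
        omega

end Flexible

/-! ### Gaps between separated edges. -/

/-- If the mean gap of `p` is at most `(t - 2) / (k - 1)`, which is not an integer, then some gap
is smaller than this. -/
lemma exists_small_gap {t k : ℕ} (hk : 2 ≤ k) (hdvd : ¬ (k - 1) ∣ (t - 2)) {p : ℕ → ℕ}
    (hp : ∀ i, i + 1 < k → p i + 1 < p (i + 1)) (hpt : p (k - 1) + 1 < t) :
    ∃ m, m + 1 < k ∧ (k - 1) * (p (m + 1) - p m) < t - 2 := by
  by_contra! hcon
  -- By indivisibility, gaps that are not small satisfy `(k - 1) * gap ≥ t - 1`. Summing over all `k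
  -- - 1` gaps pushes `p (k - 1)` up to at least `p 0 + t - 1`.
  have key : ∀ m, m < k → m * (t - 1) + (k - 1) * p 0 ≤ (k - 1) * p m := by
    intro m
    induction m with
    | zero => intro _; simp
    | succ m ih =>
      intro hm
      have h₁ := ih (by omega)
      have h₂ := hcon m hm
      have h₃ : t - 2 ≠ (k - 1) * (p (m + 1) - p m) := fun h => hdvd ⟨_, h⟩
      have h₄ := hp m hm
      have h₅ : (k - 1) * p (m + 1) = (k - 1) * (p (m + 1) - p m) + (k - 1) * p m := by
        rw [← Nat.mul_add]
        congr 1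
        omega
      have h₆ : (m + 1) * (t - 1) = m * (t - 1) + (t - 1) := by ring
      omega
  have h := key (k - 1) (by omega)
  have : (k - 1) * (t - 1 + p 0) ≤ (k - 1) * p (k - 1) := by
    rw [Nat.mul_add]
    exact h
  have := Nat.le_of_mul_le_mul_left this (by omega)
  omega

lemma lt_of_gaps {k : ℕ} {p : ℕ → ℕ} (hp : ∀ i, i + 1 < k → p i + 1 < p (i + 1)) :
    ∀ {i j : ℕ}, i < j → j < k → p i + 1 < p j := by
  intro i j hij hj
  induction j with
  | zero => omega
  | succ j ih =>
    rcases Nat.lt_succ_iff_lt_or_eq.1 hij with h | rfl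
    · have := ih h (by omega)
      have := hp j hj
      omega
    · exact hp i hj

/-! ### Recombining paths when every end of the `k` edges can be moved alone. -/

section Pinned

variable {V : Type*} {G : SimpleGraph V} {P : Set (ℕ → V)} {t k M N : ℕ} {p : ℕ → ℕ}
  {X Y : ℕ → Set ℕ}

/-- If the variable set `W`, which contains `p j + 1` for `j ≤ m` and `p j` for `j > m`, misses a
position between `p m + 1` and `p (m + 1)`, then a free path can be put in front of the members
of `P`. -/
lemma exists_flexible_of_not_mem (hM : N + 2 * t ≤ M) (hP : ∀ f ∈ P, IsPathOn G t f)
    (hne : P.Nonempty) (hp : ∀ i, i + 1 < k → p i + 1 < p (i + 1)) (hpt : p (k - 1) + 1 < t)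
    {m : ℕ} (hm : m + 1 < k) {A A' W : Set ℕ} (hA : Stable P t M A) (hA' : Stable P t M A')
    (hW : Stable P t M W) (hA₀ : p 0 ∉ A) (hA₁ : p 0 + 1 ∈ A) (hA₀' : p 0 ∈ A')
    (hA₁' : p 0 + 1 ∉ A') (hWX : ∀ j ≤ m, p j + 1 ∈ W ∧ p j ∉ W)
    (hWY : ∀ j, m < j → j < k → p j ∈ W ∧ p j + 1 ∉ W)
    {z : ℕ} (hz₁ : p m < z) (hz₂ : z ≤ p (m + 1)) (hz : z ∉ W) :
    ∃ g W, Alternates k W t ∧ Flexible {f | IsPathOn G t f} t N g W := by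
  obtain ⟨v, hv⟩ := hne
  have hlt : ∀ {i j : ℕ}, i < j → j < k → p i + 1 < p j := lt_of_gaps hp
  have hzX : z ≠ p m + 1 := fun h => hz (h ▸ (hWX m le_rfl).1)
  have hzY : z ≠ p (m + 1) := fun h => hz (h ▸ (hWY (m + 1) (by omega) hm).1)
  have h0k : p 0 + 1 < p (k - 1) := hlt (by omega) (by omega)
  have hle : ∀ j < k, p 0 ≤ p j := fun j hj => by
    rcases Nat.eq_zero_or_pos j with rfl | h
    · exact le_rfl
    · have := hlt h hj
      omega
  -- Only the stretch from `p 0` to `p (k - 1)` is kept. It has at most `t - 1` vertices because `p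
  -- (k - 1) + 1 < t`, so the prefix is nonempty and contributes a segment.
  obtain ⟨n, hn⟩ : ∃ n, n = p (k - 1) + 1 - p 0 := ⟨_, rfl⟩
  obtain ⟨L, hL⟩ : ∃ L, L = t - n := ⟨_, rfl⟩
  have hbase : Flexible {f | IsPathOn G n f} n N (fun i => v (p 0 + i)) {i | p 0 + i ∈ W} := by
    intro B hB
    obtain ⟨f, hf, h₁, h₂⟩ := hW v hv B (by omega)
    exact ⟨fun i => f (p 0 + i), (hP f hf).shift (by omega), fun i hi => h₁ _ (by omega),
      fun i hi => h₂ _ (by omega)⟩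
  -- The prefix zigzags along edges at positions `p 0` and `p 0 + 1`: `A` moves the second end with
  -- the first one fixed, `A'` does the reverse.
  have hZ : ∀ x, (∃ u ∈ P, x = u (p 0) ∨ x = u (p 0 + 1)) → ∀ F : Finset V, F.card ≤ M →
      ∃ y ∉ F, (∃ u ∈ P, y = u (p 0) ∨ y = u (p 0 + 1)) ∧ G.Adj x y := by
    rintro x ⟨u, hu, rfl | rfl⟩ F hF
    · obtain ⟨f, hf, h₁, h₂⟩ := hA u hu F hF
      refine ⟨f (p 0 + 1), h₂ _ (by omega) hA₁, ⟨f, hf, Or.inr rfl⟩, ?_⟩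
      rw [← h₁ (p 0) (by omega) hA₀]
      exact (hP f hf).2 _ (by omega)
    · obtain ⟨f, hf, h₁, h₂⟩ := hA' u hu F hF
      refine ⟨f (p 0), h₂ _ (by omega) hA₀', ⟨f, hf, Or.inl rfl⟩, ?_⟩
      rw [← h₁ (p 0 + 1) (by omega) hA₁']
      exact ((hP f hf).2 _ (by omega)).symm
  have hflex := hbase.prefix (L := L) hZ (by omega) (hWX 0 (by omega)).2 ⟨v, hv, Or.inl rfl⟩
    (by omega)
  refine ⟨_, _, ?_, hflex.mono (fun f (hf : IsPathOn G (L + n) f) => hf.mono (by omega))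
    (by omega) le_rfl⟩
  have hmem : ∀ x, p 0 ≤ x → (L + (x - p 0) ∈ {i | i < L ∨ i - L ∈ {i | p 0 + i ∈ W}} ↔
      x ∈ W) := by
    intro x hx
    simp only [Set.mem_ofPred_eq]
    rw [show p 0 + (L + (x - p 0) - L) = x by omega]
    simp
  -- The variable positions are one in the prefix and, shifted, `p j + 1` for `j ≤ m` and `p j` for
  -- `j > m`. The separators are `p j` for `j ≤ m`, then `z`, then `p j + 1` for `m < j < k - 1`.
  refine ⟨fun j => if j = 0 then 0
      else L + ((if j ≤ m + 1 then p (j - 1) + 1 else p (j - 1)) - p 0),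
    fun j => L + ((if j ≤ m then p j else if j = m + 1 then z else p (j - 1) + 1) - p 0),
    fun j hj => ?_, fun j hj => ⟨?_, ?_, ?_⟩, ?_⟩
  · dsimp only
    split_ifs with h₁ h₂
    · exact Or.inl (by omega)
    · rw [hmem _ (by have := hle (j - 1) (by omega); omega)]
      exact (hWX _ (by omega)).1
    · rw [hmem _ (hle (j - 1) (by omega))]
      exact (hWY _ (by omega) (by omega)).1
  · dsimp only
    have := hle (j - 1) (by omega)
    rcases lt_trichotomy j (m + 1) with h | h | h
    · rw [if_pos (show j ≤ m by omega)]
      rcases Nat.eq_zero_or_pos j with h₀ | h₀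
      · rw [if_pos h₀]
        omega
      · rw [if_neg (show ¬ j = 0 by omega), if_pos (show j ≤ m + 1 by omega)]
        have := hlt (show j - 1 < j by omega) hj
        omega
    · rw [if_neg (show ¬ j = 0 by omega), if_pos (show j ≤ m + 1 by omega),
        if_neg (show ¬ j ≤ m by omega), if_pos h, show j - 1 = m by omega]
      have := hle m (by omega)
      omega
    · rw [if_neg (show ¬ j = 0 by omega), if_neg (show ¬ j ≤ m + 1 by omega),
        if_neg (show ¬ j ≤ m by omega), if_neg (show ¬ j = m + 1 by omega)]
      omega
  · dsimp only
    have := hle j hj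
    rw [if_neg (show ¬ j + 1 = 0 by omega), Nat.add_sub_cancel]
    rcases lt_trichotomy j (m + 1) with h | h | h
    · rw [if_pos (show j ≤ m by omega), if_pos (show j + 1 ≤ m + 1 by omega)]
      omega
    · rw [if_neg (show ¬ j + 1 ≤ m + 1 by omega), if_neg (show ¬ j ≤ m by omega), if_pos h, h]
      have := hle m (by omega)
      omega
    · rw [if_neg (show ¬ j + 1 ≤ m + 1 by omega), if_neg (show ¬ j ≤ m by omega),
        if_neg (show ¬ j = m + 1 by omega)]
      have := hlt (show j - 1 < j by omega) hj
      have := hle (j - 1) (by omega)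
      omega
  · dsimp only
    split_ifs with h₁ h₂
    · rw [hmem _ (hle j hj)]
      exact (hWX _ h₁).2
    · rw [hmem _ (by have := hle m (by omega); omega)]
      exact hz
    · rw [hmem _ (by have := hle (j - 1) (by omega); omega)]
      exact (hWY _ (by omega) (by omega)).2
  · dsimp only
    rw [if_neg (by omega), if_neg (by omega)]
    omega

/-- Two stable sets that separate `α` from `β`, and a third one that frees precisely the interior
of the interval from `α` to `β`, yield a chain of links. -/
lemma exists_flexible_of_interval (hk : 2 ≤ k) (hM : N + 2 * t ≤ M)
    (hP : ∀ f ∈ P, IsPathOn G t f) (hne : P.Nonempty)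
    {α β : ℕ} (hαβ : α + 1 < β) (hβ : β < t) (hlen : (k - 1) * (β - α) < t - 2)
    {Θ A B A' : Set ℕ} (hΘ : Stable P t M Θ) (hA : Stable P t M A) (hB : Stable P t M B)
    (hA' : Stable P t M A') (hΘα : α ∉ Θ) (hΘβ : β ∉ Θ) (hΘi : ∀ i, α < i → i < β → i ∈ Θ)
    (hAα : α ∈ A) (hAβ : β ∉ A) (hBα : α ∉ B) (hBβ : β ∈ B) (hBβ' : β - 1 ∉ B)
    (hAβ' : β - 1 ∈ A') (hAβ'' : β ∉ A') :
    ∃ g W, Alternates k W t ∧ Flexible {f | IsPathOn G t f} t N g W := by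
  obtain ⟨v, hv⟩ := hne
  obtain ⟨d, hd⟩ : ∃ d, d = β - α := ⟨_, rfl⟩
  have hlink : ∀ u ∈ P, Linked G M d (u α) (u β) := by
    intro u hu F hF
    obtain ⟨f, hf, h₁, h₂⟩ := hΘ u hu F hF
    refine ⟨fun i => f (α + i), (hP f hf).shift (by omega), h₁ _ (by omega) hΘα, ?_,
      fun i hi₀ hi => h₂ _ (by omega) (hΘi _ (by omega) (by omega))⟩
    change f (α + d) = u β
    rw [← h₁ β hβ hΘβ, show α + d = β by omega]
  -- Links are traversed in alternating directions: `B` moves the end at `β` with `α` fixed, `A`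
  -- moves the end at `α` with `β` fixed. Each altered path is again in `P`, so `Θ` frees its
  -- interior.
  have hHub : ∀ x, (∃ u ∈ P, x = u α ∨ x = u β) → ∀ F : Finset V, F.card ≤ M →
      ∃ y ∉ F, (∃ u ∈ P, y = u α ∨ y = u β) ∧ Linked G M d x y := by
    rintro x ⟨u, hu, rfl | rfl⟩ F hF
    · obtain ⟨f, hf, h₁, h₂⟩ := hB u hu F hF
      refine ⟨f β, h₂ _ hβ hBβ, ⟨f, hf, Or.inr rfl⟩, ?_⟩
      rw [← h₁ α (by omega) hBα]
      exact hlink f hf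
    · obtain ⟨f, hf, h₁, h₂⟩ := hA u hu F hF
      refine ⟨f α, h₂ _ (by omega) hAα, ⟨f, hf, Or.inl rfl⟩, ?_⟩
      rw [← h₁ β hβ hAβ]
      exact (hlink f hf).symm
  have hZ : ∀ x, (∃ u ∈ P, x = u (β - 1) ∨ x = u β) → ∀ F : Finset V, F.card ≤ M →
      ∃ y ∉ F, (∃ u ∈ P, y = u (β - 1) ∨ y = u β) ∧ G.Adj x y := by
    have hadj : ∀ f ∈ P, G.Adj (f (β - 1)) (f β) := fun f hf => by
      have := (hP f hf).2 (β - 1) (by omega)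
      rwa [show β - 1 + 1 = β by omega] at this
    rintro x ⟨u, hu, rfl | rfl⟩ F hF
    · obtain ⟨f, hf, h₁, h₂⟩ := hB u hu F hF
      refine ⟨f β, h₂ _ hβ hBβ, ⟨f, hf, Or.inr rfl⟩, ?_⟩
      rw [← h₁ (β - 1) (by omega) hBβ']
      exact hadj f hf
    · obtain ⟨f, hf, h₁, h₂⟩ := hA' u hu F hF
      refine ⟨f (β - 1), h₂ _ (by omega) hAβ', ⟨f, hf, Or.inl rfl⟩, ?_⟩
      rw [← h₁ β hβ hAβ'']
      exact (hadj f hf).symm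
  -- With this length the hubs lie at `L, L + d, ..., L + (k - 1) * d = t - 2`. The prefix is
  -- nonempty by `hlen`, and position `t - 1` is interior to the `k`-th link since `d ≥ 2`.
  -- Truncation to `t` vertices therefore leaves `k + 1` segments.
  obtain ⟨L, hL⟩ : ∃ L, L = t - 2 - (k - 1) * d := ⟨_, rfl⟩
  rw [← hd] at hlen
  have hkd : k * d = (k - 1) * d + d := by
    obtain ⟨k, rfl⟩ : ∃ l, k = l + 1 := ⟨k - 1, by omega⟩
    rw [Nat.add_sub_cancel]
    ring
  obtain ⟨g, -, hg⟩ := exists_flexible_chain (L := L) (by omega) hZ hHub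
    ⟨v, hv, Or.inr rfl⟩ ⟨v, hv, Or.inr rfl⟩ k (by omega)
  refine ⟨g, _, ?_, (hg N (by omega)).mono
    (fun f (hf : IsPathOn G (L + k * d + 1) f) => hf.mono (by omega)) (by omega) le_rfl⟩
  have hstep : ∀ j, 0 < j → (j - 1) * d + d = j * d := by
    intro j hj
    obtain ⟨j, rfl⟩ : ∃ l, j = l + 1 := ⟨j - 1, by omega⟩
    rw [Nat.add_sub_cancel]
    ring
  refine ⟨fun j => if j = 0 then 0 else L + (j - 1) * d + 1, fun j => L + j * d, fun j hj => ?_,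
    fun j hj => ⟨?_, ?_, ?_⟩, ?_⟩
  · dsimp only
    split_ifs with h
    · exact Or.inl (by omega)
    · refine Or.inr ?_
      rw [show L + (j - 1) * d + 1 - L = (j - 1) * d + 1 by omega,
        Nat.dvd_add_right ⟨j - 1, by ring⟩]
      intro h
      have := Nat.le_of_dvd Nat.one_pos h
      omega
  · dsimp only
    split_ifs with h
    · omega
    · have := hstep j (by omega)
      omega
  · simp
  · simp
  · dsimp only
    rw [if_neg (by omega)]
    omega

/-- A family of paths whose stable sets can only be met by `k` separated edges yields a path
template with more than `k` variable segments. -/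
lemma exists_flexible_of_pinned (hk : 2 ≤ k) (hdvd : ¬ (k - 1) ∣ (t - 2)) (hM : N + 2 * t ≤ M)
    (hP : ∀ f ∈ P, IsPathOn G t f) (hne : P.Nonempty)
    (hp : ∀ i, i + 1 < k → p i + 1 < p (i + 1)) (hpt : p (k - 1) + 1 < t)
    (hX : ∀ i < k, Stable P t M (X i)) (hY : ∀ i < k, Stable P t M (Y i))
    (hXm : ∀ i < k, p i + 1 ∈ X i) (hXn : ∀ i < k, ∀ j < k, p j ∉ X i)
    (hXn' : ∀ i < k, ∀ j < k, j ≠ i → p j + 1 ∉ X i)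
    (hYm : ∀ i < k, p i ∈ Y i) (hYn : ∀ i < k, ∀ j < k, p j + 1 ∉ Y i)
    (hYn' : ∀ i < k, ∀ j < k, j ≠ i → p j ∉ Y i) :
    ∃ g W, Alternates k W t ∧ Flexible {f | IsPathOn G t f} t N g W := by
  by_contra hno
  have halt : ∀ U, Stable P t M U → ¬ Alternates k U t := fun U hU hUalt =>
    hno ⟨_, U, hUalt, (hU _ hne.some_mem).mono hP le_rfl (by omega)⟩
  have hlt : ∀ {i j : ℕ}, i < j → j < k → p i + 1 < p j := lt_of_gaps hp
  obtain ⟨m, hm, hgap⟩ := exists_small_gap hk hdvd hp hpt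
  have hpm := hp m hm
  have hmt : p (m + 1) + 1 < t := by
    rcases Nat.lt_or_ge (m + 1) (k - 1) with h | h
    · have := hlt h (by omega)
      omega
    · rwa [show m + 1 = k - 1 by omega]
  -- On each edge, `W` frees the end that faces the gap between `p m` and `p (m + 1)`, while `W'`
  -- frees the end that faces away from it.
  obtain ⟨W, hWdef⟩ : ∃ W : Set ℕ, W = {x | ∃ j < k, x ∈ if j ≤ m then X j else Y j} := ⟨_, rfl⟩
  obtain ⟨W', hWdef'⟩ : ∃ W : Set ℕ, W = {x | ∃ j < k, x ∈ if j ≤ m then Y j else X j} := ⟨_, rfl⟩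
  have hWs : Stable P t M W := hWdef ▸ Stable.biUnion k fun j hj => by
    split_ifs
    exacts [hX j hj, hY j hj]
  have hWs' : Stable P t M W' := hWdef' ▸ Stable.biUnion k fun j hj => by
    split_ifs
    exacts [hY j hj, hX j hj]
  have hWX : ∀ j ≤ m, p j + 1 ∈ W ∧ p j ∉ W := by
    intro j hj
    rw [hWdef]
    refine ⟨⟨j, by omega, by rw [if_pos hj]; exact hXm j (by omega)⟩, ?_⟩
    rintro ⟨i, hi, hmem⟩
    split_ifs at hmem
    · exact hXn i hi j (by omega) hmem
    · exact hYn' i hi j (by omega) (by omega) hmem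
  have hWY : ∀ j, m < j → j < k → p j ∈ W ∧ p j + 1 ∉ W := by
    intro j hj hjk
    rw [hWdef]
    refine ⟨⟨j, by omega, by rw [if_neg (by omega)]; exact hYm j (by omega)⟩, ?_⟩
    rintro ⟨i, hi, hmem⟩
    split_ifs at hmem
    · exact hXn' i hi j (by omega) (by omega) hmem
    · exact hYn i hi j (by omega) hmem
  have hWY' : ∀ j ≤ m, p j ∈ W' ∧ p j + 1 ∉ W' := by
    intro j hj
    rw [hWdef']
    refine ⟨⟨j, by omega, by rw [if_pos hj]; exact hYm j (by omega)⟩, ?_⟩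
    rintro ⟨i, hi, hmem⟩
    split_ifs at hmem
    · exact hYn i hi j (by omega) hmem
    · exact hXn' i hi j (by omega) (by omega) hmem
  have hWX' : ∀ j, m < j → j < k → p j + 1 ∈ W' ∧ p j ∉ W' := by
    intro j hj hjk
    rw [hWdef']
    refine ⟨⟨j, by omega, by rw [if_neg (by omega)]; exact hXm j (by omega)⟩, ?_⟩
    rintro ⟨i, hi, hmem⟩
    split_ifs at hmem
    · exact hYn' i hi j (by omega) (by omega) hmem
    · exact hXn i hi j (by omega) hmem
  have hfull : ∀ z, p m < z → z ≤ p (m + 1) → z ∈ W := by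
    intro z hz₁ hz₂
    by_contra hz
    exact hno (exists_flexible_of_not_mem hM hP hne hp hpt hm (hX 0 (by omega)) (hY 0 (by omega))
      hWs (hXn 0 (by omega) 0 (by omega)) (hXm 0 (by omega)) (hYm 0 (by omega))
      (hYn 0 (by omega) 0 (by omega)) hWX hWY hz₁ hz₂ hz)
  obtain ⟨Θ, hΘdef⟩ : ∃ W : Set ℕ, W = {x | ∃ j < k, x ∈ Y j} := ⟨_, rfl⟩
  have hΘs : Stable P t M Θ := hΘdef ▸ Stable.biUnion k hY
  have hΘn : ∀ j < k, p j + 1 ∉ Θ := by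
    rintro j hj h
    rw [hΘdef] at h
    obtain ⟨i, hi, h⟩ := h
    exact hYn i hi j hj h
  have hΘp : p (m + 1) ∈ Θ := hΘdef ▸ ⟨m + 1, hm, hYm _ hm⟩
  classical
  -- `Θ` fixes `α` and `p (m + 1) + 1` and frees everything between. As `α ≥ p m + 1`, this interval
  -- is no longer than the small gap.
  obtain ⟨α, hα⟩ : ∃ α, α = Nat.findGreatest (· ∉ Θ) (p (m + 1)) := ⟨_, rfl⟩
  have hα₁ : p m + 1 ≤ α := hα ▸ Nat.le_findGreatest hpm.le (hΘn m (by omega))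
  have hα₂ : α ≤ p (m + 1) := hα ▸ Nat.findGreatest_le _
  have hα₃ : α ∉ Θ := by
    have := Nat.findGreatest_spec (P := (· ∉ Θ)) hpm.le (hΘn m (by omega))
    rwa [← hα] at this
  have hα₄ : ∀ i, α < i → i ≤ p (m + 1) → i ∈ Θ := fun i h₁ h₂ =>
    not_not.1 (Nat.findGreatest_is_greatest (P := (· ∉ Θ)) (hα ▸ h₁) h₂)
  have hα₅ : α ≠ p (m + 1) := fun h => hα₃ (h ▸ hΘp)
  -- Otherwise `α`, enclosed by the fixed positions `p m + 1` and `p (m + 1)`, would give the stable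
  -- set `W'` an additional segment.
  have hαX : α ∉ X (m + 1) := by
    intro hmem
    have hα₆ : α ≠ p m + 1 := fun h => hXn' (m + 1) hm m (by omega) (by omega) (h ▸ hmem)
    have hαW' : α ∈ W' := hWdef' ▸ ⟨m + 1, hm, by rwa [if_neg (by omega)]⟩
    refine halt W' hWs' ⟨fun j => if j ≤ m then p j else if j = m + 1 then α else p (j - 1) + 1,
      fun j => if j ≤ m then p j + 1 else p j, fun j hj => ?_, fun j hj => ⟨?_, ?_, ?_⟩, ?_⟩
    · dsimp only
      split_ifs with h₁ h₂
      · exact (hWY' j h₁).1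
      · exact hαW'
      · exact (hWX' _ (by omega) (by omega)).1
    · dsimp only
      split_ifs with h₁ h₂
      · omega
      · subst h₂
        omega
      · exact hlt (by omega) hj
    · dsimp only
      split_ifs with h₁ h₂ h₃ h₄ h₅
      all_goals first | omega | skip
      · exact hp j (by omega)
      · obtain rfl : j = m := by omega
        omega
      · simp
    · dsimp only
      split_ifs with h₁
      · exact (hWY' j h₁).2
      · exact (hWX' j (by omega) hj).2
    · dsimp only
      rw [if_neg (by omega), if_neg (by omega)]
      exact hpt
  refine hno (exists_flexible_of_interval (α := α) (β := p (m + 1) + 1) hk hM hP hne (by omega) hmt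
    (lt_of_le_of_lt (Nat.mul_le_mul_left _ (by omega)) hgap) hΘs hWs (hX (m + 1) hm) (hY (m + 1) hm)
    hα₃ (hΘn _ hm) (fun i h₁ h₂ => hα₄ i h₁ (by omega)) (hfull α (by omega) hα₂)
    (hWY (m + 1) (by omega) hm).2 hαX (hXm _ hm) ?_ ?_ (hYn _ hm _ hm))
  · simpa using hXn (m + 1) hm (m + 1) hm
  · simpa using hYm (m + 1) hm

end Pinned

/-! ### Edge transversals of union-closed families on a path. -/

section Transversal

variable {𝒰 : Set (Set ℕ)} {t k : ℕ}

lemma exists_least_max (hne : ∀ U ∈ 𝒰, U.Nonempty) (hlt : ∀ U ∈ 𝒰, ∀ x ∈ U, x < t)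
    {Q : Set ℕ → Prop} (hQ : ∃ U ∈ 𝒰, Q U) :
    ∃ n, ∃ U ∈ 𝒰, Q U ∧ n ∈ U ∧ (∀ x ∈ U, x ≤ n) ∧ ∀ U' ∈ 𝒰, Q U' → ∃ x ∈ U', n ≤ x := by
  classical
  have h : ∃ n, ∃ U ∈ 𝒰, Q U ∧ ∀ x ∈ U, x ≤ n := by
    obtain ⟨U, hU, hQU⟩ := hQ
    exact ⟨t, U, hU, hQU, fun x hx => (hlt U hU x hx).le⟩
  obtain ⟨U, hU, hQU, hmax⟩ := Nat.find_spec h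
  have hall : ∀ U' ∈ 𝒰, Q U' → ∃ x ∈ U', Nat.find h ≤ x := by
    intro U' hU' hQU'
    by_contra! hcon
    obtain ⟨y, hy⟩ := hne U' hU'
    have := hcon y hy
    refine Nat.find_min h (m := Nat.find h - 1) (by omega) ⟨U', hU', hQU', fun x hx => ?_⟩
    have := hcon x hx
    omega
  obtain ⟨x, hx, hle⟩ := hall U hU hQU
  have hxn : x = Nat.find h := le_antisymm (hmax x hx) hle
  exact ⟨_, U, hU, hQU, hxn ▸ hx, hmax, hall⟩

/-- A union-closed family without alternating members is met by `k` separated edges. -/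
lemma exists_edge_transversal (hun : ∀ U ∈ 𝒰, ∀ U' ∈ 𝒰, U ∪ U' ∈ 𝒰)
    (hne : ∀ U ∈ 𝒰, U.Nonempty) (hlt : ∀ U ∈ 𝒰, ∀ x ∈ U, x < t)
    (halt : ∀ U ∈ 𝒰, ¬ Alternates k U t) (h𝒰 : 𝒰.Nonempty) :
    ∃ i < k, ∃ p : ℕ → ℕ, (∀ j < i, p j + 1 < p (j + 1)) ∧ p i < t ∧
      ∀ U ∈ 𝒰, ∃ j ≤ i, p j ∈ U ∨ p j + 1 ∈ U := by
  -- Greedily, `p i` is the least possible maximum of a member that misses the earlier edges. The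
  -- union `W` of the chosen members contains every `p j` but no `p j + 1`: the members chosen up to
  -- step `j` end by `p j`, and the later ones miss the edge. After `k + 1` choices `W` would
  -- alternate.
  have key : ∀ i, (∃ i' < i, ∃ p : ℕ → ℕ, (∀ j < i', p j + 1 < p (j + 1)) ∧ p i' < t ∧
      ∀ U ∈ 𝒰, ∃ j ≤ i', p j ∈ U ∨ p j + 1 ∈ U) ∨
      ∃ p : ℕ → ℕ, ∃ W ∈ 𝒰, (∀ j < i, p j + 1 < p (j + 1)) ∧ (∀ j ≤ i, p j ∈ W ∧ p j + 1 ∉ W) ∧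
        (∀ x ∈ W, x ≤ p i) ∧
        ∀ U ∈ 𝒰, (∀ j < i, p j ∉ U ∧ p j + 1 ∉ U) → ∃ x ∈ U, p i ≤ x := by
    intro i
    induction i with
    | zero =>
      obtain ⟨n, U, hU, -, hn, hmax, hall⟩ := exists_least_max (Q := fun _ => True) hne hlt
        ⟨_, h𝒰.some_mem, trivial⟩
      refine Or.inr ⟨fun _ => n, U, hU, fun _ h => by omega, fun j _ => ⟨hn, fun h => ?_⟩, hmax,
        fun U' hU' _ => hall U' hU' trivial⟩
      exact absurd (hmax _ h) (Nat.not_succ_le_self n)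
    | succ i ih =>
      rcases ih with ⟨i', hi', h⟩ | ⟨p, W, hW, hp, hpW, hWmax, hall⟩
      · exact Or.inl ⟨i', by omega, h⟩
      by_cases hhit : ∀ U ∈ 𝒰, ∃ j ≤ i, p j ∈ U ∨ p j + 1 ∈ U
      · exact Or.inl ⟨i, by omega, p, hp, hlt W hW _ (hpW i le_rfl).1, hhit⟩
      push Not at hhit
      obtain ⟨n, U, hU, hQU, hn, hmax, hmin⟩ := exists_least_max hne hlt hhit
      have hni : p i + 1 < n := by
        obtain ⟨x, hx, hle⟩ := hall U hU fun j hj => hQU j hj.le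
        have h₁ := hmax x hx
        have h₂ : n ≠ p i := fun h => (hQU i le_rfl).1 (h ▸ hn)
        have h₃ : n ≠ p i + 1 := fun h => (hQU i le_rfl).2 (h ▸ hn)
        omega
      refine Or.inr ⟨fun j => if j ≤ i then p j else n, W ∪ U, hun W hW U hU, fun j hj => ?_,
        fun j hj => ?_, fun x hx => ?_, fun U' hU' hQU' => ?_⟩
      · dsimp only
        rw [if_pos (by omega)]
        split_ifs with h
        · exact hp j (by omega)
        · rwa [show j = i by omega]
      · dsimp only
        split_ifs with h
        · exact ⟨Or.inl (hpW j h).1, fun hmem => hmem.elim (hpW j h).2 (hQU j h).2⟩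
        · refine ⟨Or.inr hn, fun hmem => hmem.elim (fun h => ?_) (fun h => ?_)⟩
          · have := hWmax _ h
            omega
          · have := hmax _ h
            omega
      · dsimp only
        rw [if_neg (by omega)]
        rcases hx with hx | hx
        · have := hWmax _ hx
          omega
        · exact hmax x hx
      · dsimp only
        rw [if_neg (by omega)]
        refine hmin U' hU' fun j hj => ?_
        simpa [hj] using hQU' j (by omega)
  rcases key k with h | ⟨p, W, hW, hp, hpW, -⟩
  · exact h
  · exact absurd ⟨p, fun j => p j + 1, fun i hi => (hpW i hi).1,
      fun i hi => ⟨Nat.lt_succ_self _, hp i hi, (hpW i hi.le).2⟩, hlt W hW _ (hpW k le_rfl).1⟩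
      (halt W hW)

/-- Either `k - 1` edges and a vertex meet all members, or the members separate the end
vertices of `k` edges. -/
lemma exists_transversal_or_pinned (hk : 2 ≤ k) (ht : 2 ≤ t)
    (hun : ∀ U ∈ 𝒰, ∀ U' ∈ 𝒰, U ∪ U' ∈ 𝒰)
    (hne : ∀ U ∈ 𝒰, U.Nonempty) (hlt : ∀ U ∈ 𝒰, ∀ x ∈ U, x < t)
    (halt : ∀ U ∈ 𝒰, ¬ Alternates k U t) :
    (∃ p : ℕ → ℕ, ∃ r < t, (∀ j < k - 1, p j + 1 < t) ∧
      ∀ U ∈ 𝒰, r ∈ U ∨ ∃ j < k - 1, p j ∈ U ∨ p j + 1 ∈ U) ∨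
    ∃ p : ℕ → ℕ, (∀ i, i + 1 < k → p i + 1 < p (i + 1)) ∧ p (k - 1) + 1 < t ∧ ∀ i < k,
      (∃ X ∈ 𝒰, p i + 1 ∈ X ∧ (∀ j < k, p j ∉ X) ∧ ∀ j < k, j ≠ i → p j + 1 ∉ X) ∧
      ∃ Y ∈ 𝒰, p i ∈ Y ∧ (∀ j < k, p j + 1 ∉ Y) ∧ ∀ j < k, j ≠ i → p j ∉ Y := by
  rw [or_iff_not_imp_left]
  intro hno
  have h𝒰 : 𝒰.Nonempty := by
    by_contra h
    rw [Set.not_nonempty_iff_eq_empty] at h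
    subst h
    exact hno ⟨fun _ => 0, 0, by omega, fun _ _ => ht, fun _ h => h.elim⟩
  obtain ⟨i, hi, p, hp, hpt, hhit⟩ := exists_edge_transversal hun hne hlt halt h𝒰
  have hlt' : ∀ j < i, p j + 1 < t := fun j hj => by
    have := lt_of_gaps (k := i + 1) (fun j hj => hp j (by omega)) hj (by omega)
    omega
  have hpt' : p i + 1 < t := by
    by_contra hcon
    -- If the last edge sticks out of the path, so that `p i = t - 1`, it acts as a single vertex.
    refine hno ⟨fun j => if j < i then p j else 0, p i, hpt, fun j hj => ?_, fun U hU => ?_⟩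
    · dsimp only
      split_ifs with h
      · exact hlt' j h
      · omega
    · obtain ⟨j, hj, hjU⟩ := hhit U hU
      rcases Nat.lt_or_ge j i with h | h
      · exact Or.inr ⟨j, by omega, by simpa [h] using hjU⟩
      · obtain rfl : j = i := by omega
        refine Or.inl (hjU.resolve_right fun hmem => ?_)
        have := hlt U hU _ hmem
        omega
  obtain rfl : i = k - 1 := by
    by_contra hik
    refine hno ⟨fun j => if j ≤ i then p j else 0, 0, by omega, fun j hj => ?_, fun U hU => ?_⟩
    · dsimp only
      split_ifs with h
      · rcases Nat.lt_or_ge j i with h' | h'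
        · exact hlt' j h'
        · rwa [show j = i by omega]
      · omega
    · obtain ⟨j, hj, hjU⟩ := hhit U hU
      exact Or.inr ⟨j, by omega, by simpa [hj] using hjU⟩
  have hlt'' : ∀ j < k, p j + 1 < t := fun j hj => by
    rcases Nat.lt_or_ge j (k - 1) with h | h
    · exact hlt' j h
    · rwa [show j = k - 1 by omega]
  -- Otherwise `r` and the other `k - 1` edges would meet every member. Taking for `r` one end of
  -- the `i`-th edge yields a member that meets the `k` edges in the other end only.
  have hskip : ∀ i < k, ∀ r < t, ∃ U ∈ 𝒰, r ∉ U ∧ ∀ j < k, j ≠ i → p j ∉ U ∧ p j + 1 ∉ U := by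
    intro i hi r hr
    by_contra! hcon
    refine hno ⟨fun j => if j < i then p j else p (j + 1), r, hr, fun j hj => ?_, fun U hU => ?_⟩
    · dsimp only
      split_ifs
      exacts [hlt'' j (by omega), hlt'' _ (by omega)]
    · by_cases hrU : r ∈ U
      · exact Or.inl hrU
      obtain ⟨j, hj, hji, h⟩ := hcon U hU hrU
      have h' : p j ∈ U ∨ p j + 1 ∈ U := by
        by_cases h₁ : p j ∈ U
        exacts [Or.inl h₁, Or.inr (h h₁)]
      rcases Nat.lt_or_ge j i with h₁ | h₁
      · exact Or.inr ⟨j, by omega, by simpa [h₁] using h'⟩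
      · refine Or.inr ⟨j - 1, by omega, ?_⟩
        dsimp only
        rwa [if_neg (by omega), show j - 1 + 1 = j by omega]
  refine ⟨p, fun j hj => hp j (by omega), hpt', fun i hi => ⟨?_, ?_⟩⟩
  · obtain ⟨U, hU, hr, hU'⟩ := hskip i hi (p i) (by have := hlt'' i hi; omega)
    obtain ⟨j, hj, hjU⟩ := hhit U hU
    have hji : j = i := by
      by_contra h
      have := hU' j (by omega) h
      tauto
    refine ⟨U, hU, ?_, fun j hj => ?_, fun j hj h => (hU' j hj h).2⟩
    · rw [hji] at hjU
      exact hjU.resolve_left hr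
    · by_cases h : j = i
      · rwa [h]
      · exact (hU' j hj h).1
  · obtain ⟨U, hU, hr, hU'⟩ := hskip i hi (p i + 1) (hlt'' i hi)
    obtain ⟨j, hj, hjU⟩ := hhit U hU
    have hji : j = i := by
      by_contra h
      have := hU' j (by omega) h
      tauto
    refine ⟨U, hU, ?_, fun j hj => ?_, fun j hj h => (hU' j hj h).1⟩
    · rw [hji] at hjU
      exact hjU.resolve_right hr
    · by_cases h : j = i
      · rwa [h]
      · exact (hU' j hj h).2

end Transversal

/-! ### Delta-system cleaning of families of tuples. -/

section Clean

variable {ι V : Type*}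

/-- In `H`, the values on `R` determine the value at `i`. -/
def Determines (H : Finset (ι → V)) (R : Finset ι) (i : ι) : Prop :=
  ∀ f ∈ H, ∀ g ∈ H, (∀ j ∈ R, f j = g j) → f i = g i

/-- For every set `B` of at most `M` elements, `H` has a member that agrees with `f` outside `U`
and avoids `B` on `U`. -/
def FlexibleAt (H : Finset (ι → V)) (M : ℕ) (f : ι → V) (U : Finset ι) : Prop :=
  ∀ B : Finset V, B.card ≤ M → ∃ f' ∈ H, (∀ i ∉ U, f' i = f i) ∧ ∀ i ∈ U, f' i ∉ B

/-- Removing the fibres that violate flexibility, until none is left. -/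
lemma exists_flexible_part (𝓛 : Finset (Finset ι)) (M : ℕ) (H : Finset (ι → V)) :
    ∃ H₀ ⊆ H, ∃ 𝓝 : Finset ι → Finset (ι → V),
      (∀ f ∈ H, f ∈ H₀ ∨ ∃ U ∈ 𝓛, f ∈ 𝓝 U) ∧ (∀ U ∈ 𝓛, ∀ f ∈ H₀, FlexibleAt H₀ M f U) ∧
      ∀ U, 𝓝 U ⊆ H ∧ ∃ b : (ι → V) → Finset V,
        (∀ f g, (∀ i ∉ U, f i = g i) → b f = b g) ∧ (∀ f, (b f).card ≤ M) ∧
        ∀ f ∈ 𝓝 U, ∃ i ∈ U, f i ∈ b f := by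
  classical
  induction H using Finset.strongInduction with
  | H H ih =>
    by_cases hflex : ∀ U ∈ 𝓛, ∀ f ∈ H, FlexibleAt H M f U
    · exact ⟨H, subset_rfl, fun _ => ∅, fun f hf => Or.inl hf, hflex, fun U =>
        ⟨Finset.empty_subset _, fun _ => ∅, fun _ _ _ => rfl, fun _ => by simp,
          fun f hf => absurd hf (Finset.notMem_empty f)⟩⟩
    · simp only [FlexibleAt] at hflex
      push Not at hflex
      obtain ⟨U, hU, f₀, hf₀, B, hB, hbad⟩ := hflex
      obtain ⟨F, hF⟩ : ∃ F, F = H.filter fun f => ∀ i ∉ U, f i = f₀ i := ⟨_, rfl⟩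
      have hmem : ∀ f, f ∈ F ↔ f ∈ H ∧ ∀ i ∉ U, f i = f₀ i := fun f => by
        rw [hF, Finset.mem_filter]
      obtain ⟨H₀, hH₀, 𝓝, hcov, hfl, h𝓝⟩ := ih (H \ F)
        (Finset.sdiff_ssubset (fun f hf => ((hmem f).1 hf).1)
          ⟨f₀, (hmem f₀).2 ⟨hf₀, fun _ _ => rfl⟩⟩)
      refine ⟨H₀, hH₀.trans Finset.sdiff_subset, Function.update 𝓝 U (𝓝 U ∪ F), ?_, hfl,
        fun U' => ?_⟩
      · intro f hf
        by_cases hfF : f ∈ F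
        · exact Or.inr ⟨U, hU, by simp [hfF]⟩
        · rcases hcov f (Finset.mem_sdiff.2 ⟨hf, hfF⟩) with h | ⟨U', hU', h⟩
          · exact Or.inl h
          · refine Or.inr ⟨U', hU', ?_⟩
            by_cases hUU : U' = U
            · subst hUU
              simp [h]
            · rwa [Function.update_of_ne hUU]
      · by_cases hUU : U' = U
        · subst hUU
          rw [Function.update_self]
          obtain ⟨hsub, b, hb₁, hb₂, hb₃⟩ := h𝓝 U'
          refine ⟨Finset.union_subset (hsub.trans Finset.sdiff_subset)
            fun f hf => ((hmem f).1 hf).1,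
            -- The parts `𝓝` of the recursion lie in `H \ F`, so redefining the covering set on the
            -- fibre `F` does not disturb them.
            fun f => if ∀ i ∉ U', f i = f₀ i then B else b f, fun f g hfg => ?_, fun f => ?_,
            fun f hf => ?_⟩
          · have : (∀ i ∉ U', f i = f₀ i) ↔ ∀ i ∉ U', g i = f₀ i :=
              forall₂_congr fun i hi => by rw [hfg i hi]
            simp only [this, hb₁ f g hfg]
          · dsimp only
            split_ifs
            exacts [hB, hb₂ f]
          · rcases Finset.mem_union.1 hf with h | h
            · have hnot : ¬ ∀ i ∉ U', f i = f₀ i := fun hcon =>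
                (Finset.mem_sdiff.1 (hsub h)).2
                  ((hmem f).2 ⟨(Finset.mem_sdiff.1 (hsub h)).1, hcon⟩)
              simp only [if_neg hnot]
              exact hb₃ f h
            · have h' := (hmem f).1 h
              simp only [if_pos h'.2]
              exact hbad f h'.1 h'.2
        · rw [Function.update_of_ne hUU]
          obtain ⟨hsub, h⟩ := h𝓝 U'
          exact ⟨hsub.trans Finset.sdiff_subset, h⟩

/-- If the fibres over the coordinates outside `U` are covered by few values, then a large part
has a coordinate in `U` that is determined by those outside `U`. -/
lemma exists_determines [Fintype ι] [DecidableEq ι] {M : ℕ} {U : Finset ι} {H : Finset (ι → V)}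
    (b : (ι → V) → Finset V) (hb : ∀ f g, (∀ i ∉ U, f i = g i) → b f = b g)
    (hM : ∀ f, (b f).card ≤ M) (hH : ∀ f ∈ H, ∃ i ∈ U, f i ∈ b f) (hne : H.Nonempty) :
    ∃ H' ⊆ H, H.card ≤ Fintype.card ι * M * H'.card ∧ ∃ i ∈ U, Determines H' Uᶜ i := by
  classical
  -- Pigeonhole over which coordinate falls into `b f` and at which place of its enumeration. Within
  -- one class, the values outside `U` fix `b f` and hence this entry.
  have hsel : ∀ f ∈ H, ∃ x : ι × Fin M, x.1 ∈ U ∧ (b f).toList[(x.2 : ℕ)]? = some (f x.1) := by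
    intro f hf
    obtain ⟨i, hi, hfi⟩ := hH f hf
    obtain ⟨m, hm⟩ := List.mem_iff_getElem?.1 (Finset.mem_toList.2 hfi)
    have hmM : m < M := by
      have := (List.getElem?_eq_some_iff.1 hm).1
      rw [Finset.length_toList] at this
      exact this.trans_le (hM f)
    exact ⟨(i, ⟨m, hmM⟩), hi, hm⟩
  have : Nonempty (ι × Fin M) := ⟨(hsel _ hne.choose_spec).choose⟩
  choose! x hx₁ hx₂ using hsel
  obtain ⟨y, hy, hmax⟩ := (H.image x).exists_max_image (fun y => (H.filter fun f => x f = y).card)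
    (hne.image x)
  refine ⟨H.filter fun f => x f = y, Finset.filter_subset _ _, ?_, y.1, ?_, ?_⟩
  · have h₁ := Finset.card_le_mul_card_image (s := H) (f := x) _ hmax
    have h₂ : (H.image x).card ≤ Fintype.card ι * M := by
      refine (Finset.card_le_univ _).trans_eq ?_
      simp
    rw [Nat.mul_comm]
    exact h₁.trans (Nat.mul_le_mul_left _ h₂)
  · obtain ⟨f, hf, rfl⟩ := Finset.mem_image.1 hy
    exact hx₁ f hf
  · intro f hf g hg hfg
    obtain ⟨hf, hfy⟩ := Finset.mem_filter.1 hf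
    obtain ⟨hg, hgy⟩ := Finset.mem_filter.1 hg
    have hbfg := hb f g fun i hi => hfg i (Finset.mem_compl.2 hi)
    have h₁ := hx₂ f hf
    have h₂ := hx₂ g hg
    rw [hfy] at h₁
    rw [hgy, ← hbfg, h₁] at h₂
    exact Option.some.inj h₂

end Clean

/-- A delta-system lemma: a positive proportion of every family of `ι`-tuples is a family such
that, for each `S`, the tuples are determined by their values on `S`, or else can be perturbed on
exactly the coordinates in some nonempty set disjoint from `S`. -/
theorem exists_homogeneous_subfamily (ι : Type*) [Fintype ι] [DecidableEq ι] (M : ℕ) :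
    ∃ C : ℕ, ∀ {V : Type*} (H : Finset (ι → V)), ∃ H' ⊆ H, H.card ≤ C * H'.card ∧
      ∀ S : Finset ι, (∀ f ∈ H', ∀ g ∈ H', (∀ i ∈ S, f i = g i) → f = g) ∨
        ∃ U : Finset ι, U.Nonempty ∧ Disjoint U S ∧ ∀ f ∈ H', FlexibleAt H' M f U := by
  classical
  -- Induction on the number of pairs `(S, i)` such that `S` does not determine `i`. Passing to a
  -- subfamily never increases it.
  have key : ∀ n : ℕ, ∃ C : ℕ, ∀ {V : Type _} (H : Finset (ι → V)),
      (Finset.univ.filter fun x : Finset ι × ι => ¬ Determines H x.1 x.2).card < n →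
      ∃ H' ⊆ H, H.card ≤ C * H'.card ∧
      ∀ S : Finset ι, (∀ f ∈ H', ∀ g ∈ H', (∀ i ∈ S, f i = g i) → f = g) ∨
        ∃ U : Finset ι, U.Nonempty ∧ Disjoint U S ∧ ∀ f ∈ H', FlexibleAt H' M f U := by
    intro n
    induction n with
    | zero => exact ⟨0, fun H h => absurd h (Nat.not_lt_zero _)⟩
    | succ n ih =>
      obtain ⟨C, hC⟩ := ih
      refine ⟨2 + 2 * (Fintype.card (Finset ι) * (Fintype.card ι * M * C)), fun {V} H hH => ?_⟩
      obtain ⟨𝓛, h𝓛⟩ : ∃ 𝓛 : Finset (Finset ι), 𝓛 = Finset.univ.filter fun U =>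
        U.Nonempty ∧ ∀ i ∈ U, ¬ Determines H Uᶜ i := ⟨_, rfl⟩
      obtain ⟨H₀, hH₀, 𝓝, hcov, hfl, h𝓝⟩ := exists_flexible_part 𝓛 M H
      by_cases hbig : H.card ≤ 2 * H₀.card
      · refine ⟨H₀, hH₀, hbig.trans (Nat.mul_le_mul_right _ (by omega)), fun S => ?_⟩
        -- `R` is the closure of `S` under determination. It determines nothing new, so if it is
        -- proper, its complement belongs to `𝓛`.
        obtain ⟨R, hR⟩ : ∃ R : Finset ι, R = Finset.univ.filter fun i => Determines H S i :=
          ⟨_, rfl⟩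
        have hmem : ∀ i, i ∈ R ↔ Determines H S i := fun i => by simp [hR]
        by_cases hRu : R = Finset.univ
        · exact Or.inl fun f hf g hg hfg => funext fun i =>
            (hmem i).1 (hRu ▸ Finset.mem_univ i) f (hH₀ hf) g (hH₀ hg) hfg
        · have hU : Rᶜ ∈ 𝓛 := by
            rw [h𝓛, Finset.mem_filter]
            refine ⟨Finset.mem_univ _, ?_, fun i hi hdet => ?_⟩
            · rw [Finset.nonempty_iff_ne_empty]
              simpa using hRu
            · rw [compl_compl] at hdet
              exact Finset.mem_compl.1 hi ((hmem i).2 fun f hf g hg hfg =>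
                hdet f hf g hg fun j hj => (hmem j).1 hj f hf g hg hfg)
          refine Or.inr ⟨Rᶜ, ?_, ?_, hfl _ hU⟩
          · rw [h𝓛, Finset.mem_filter] at hU
            exact hU.2.1
          · rw [Finset.disjoint_left]
            exact fun i hi hiS => Finset.mem_compl.1 hi
              ((hmem i).2 fun f _ g _ hfg => hfg i hiS)
      · have hsum : H.card ≤ H₀.card + ∑ U ∈ 𝓛, (𝓝 U).card := by
          refine (Finset.card_le_card (t := H₀ ∪ 𝓛.biUnion 𝓝) fun f hf => ?_).trans
            ((Finset.card_union_le _ _).trans (Nat.add_le_add_left Finset.card_biUnion_le _))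
          rw [Finset.mem_union, Finset.mem_biUnion]
          exact hcov f hf
        have h𝓛ne : 𝓛.Nonempty := by
          by_contra h
          rw [Finset.not_nonempty_iff_eq_empty] at h
          rw [h, Finset.sum_empty] at hsum
          omega
        -- Less than half survives, so some rejected part `𝓝 U` is large. In a large piece of it a
        -- coordinate of `U` becomes determined by `Uᶜ`, and the induction measure drops.
        obtain ⟨U, hU, hmax⟩ := 𝓛.exists_max_image (fun U => (𝓝 U).card) h𝓛ne
        have hsum' : ∑ U ∈ 𝓛, (𝓝 U).card ≤ Fintype.card (Finset ι) * (𝓝 U).card := by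
          refine (Finset.sum_le_card_nsmul _ _ _ hmax).trans ?_
          rw [smul_eq_mul]
          exact Nat.mul_le_mul_right _ (Finset.card_le_univ _)
        have hUne : (𝓝 U).Nonempty := by
          rw [← Finset.card_pos]
          by_contra h
          rw [show (𝓝 U).card = 0 by omega, Nat.mul_zero] at hsum'
          omega
        obtain ⟨hsub, b, hb₁, hb₂, hb₃⟩ := h𝓝 U
        obtain ⟨H₁, hH₁, hcard, i, hi, hdet⟩ := exists_determines b hb₁ hb₂ hb₃ hUne
        obtain ⟨H', hH', hcard', hgood⟩ := hC H₁ (by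
          refine lt_of_lt_of_le (Finset.card_lt_card ?_) (Nat.lt_succ_iff.1 hH)
          rw [Finset.ssubset_iff_of_subset]
          · refine ⟨(Uᶜ, i), ?_, ?_⟩
            · rw [h𝓛, Finset.mem_filter] at hU
              simpa using hU.2.2 i hi
            · simpa using hdet
          · intro x hx
            simp only [Finset.mem_filter, Finset.mem_univ, true_and] at hx ⊢
            exact fun h => hx fun f hf g hg hfg =>
              h f (hsub (hH₁ hf)) g (hsub (hH₁ hg)) hfg)
        refine ⟨H', hH'.trans (hH₁.trans hsub), ?_, hgood⟩
        have h₁ : (𝓝 U).card ≤ Fintype.card ι * M * C * H'.card := by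
          refine hcard.trans ?_
          rw [Nat.mul_assoc _ C]
          exact Nat.mul_le_mul_left _ hcard'
        have h₂ := Nat.mul_le_mul_left (Fintype.card (Finset ι)) h₁
        rw [← Nat.mul_assoc] at h₂
        rw [Nat.add_mul, Nat.mul_assoc 2]
        omega
  obtain ⟨C, hC⟩ := key (Fintype.card (Finset ι × ι) + 1)
  exact ⟨C, fun H => hC H (Nat.lt_succ_of_le (Finset.card_le_univ _))⟩

/-! ### From flexible templates to flowers. -/

lemma lt_of_reachable {t s : ℕ} {A : Set (Fin t)} (hs : ∀ i ∈ A, (i : ℕ) ≠ s) {x y : A}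
    (w : ((SimpleGraph.pathGraph t).induce A).Walk x y) (hx : (x : Fin t).val < s) :
    (y : Fin t).val < s := by
  induction w with
  | nil => exact hx
  | @cons u v _ h _ ih =>
    apply ih
    have h' : (SimpleGraph.pathGraph t).Adj u v := h
    rw [SimpleGraph.pathGraph_adj] at h'
    have := hs v v.2
    omega

/-- A walk in a path graph cannot cross a deleted position, so the positions `w i` lie in different
components. -/
lemma Alternates.le_card_connectedComponent {t k : ℕ} {W : Set ℕ} (h : Alternates k W t) :
    k + 1 ≤ Nat.card ((SimpleGraph.pathGraph t).induce
      {i : Fin t | (i : ℕ) ∉ W}ᶜ).ConnectedComponent := by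
  obtain ⟨w, s, hw, hs, ht⟩ := h
  have hmono : ∀ i j, i < j → j ≤ k → w i < s i ∧ s i < w j := by
    intro i j hij hj
    induction j with
    | zero => omega
    | succ j ih =>
      rcases Nat.lt_succ_iff_lt_or_eq.1 hij with h | rfl
      · have h₁ := ih h (by omega)
        have h₂ := hs j (by omega)
        omega
      · have h₂ := hs i (by omega)
        omega
  have hwt : ∀ i ≤ k, w i < t := by
    intro i hi
    rcases Nat.lt_or_ge i k with h | h
    · have := hmono i k h le_rfl
      omega
    · rwa [show i = k by omega]
  let φ : Fin (k + 1) → ((SimpleGraph.pathGraph t).induce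
      {i : Fin t | (i : ℕ) ∉ W}ᶜ).ConnectedComponent := fun i =>
    SimpleGraph.connectedComponentMk _
      ⟨⟨w i, hwt i (by omega)⟩, fun hcon => hcon (hw i (by omega))⟩
  have hφ : ∀ i j : Fin (k + 1), i < j → φ i ≠ φ j := by
    intro i j hij heq
    obtain ⟨p⟩ := SimpleGraph.ConnectedComponent.exact heq
    have hlt := hmono i j hij (by omega)
    have hsi : ∀ x ∈ {i : Fin t | (i : ℕ) ∉ W}ᶜ, (x : ℕ) ≠ s i := fun x hx hxs => hx (by
      change (x : ℕ) ∉ W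
      rw [hxs]
      exact (hs i (by omega)).2.2)
    have := lt_of_reachable hsi p hlt.1
    exact absurd this (by simpa using hlt.2.le)
  have hinj : Function.Injective φ := by
    intro i j heq
    rcases lt_trichotomy i j with h | h | h
    · exact absurd heq (hφ i j h)
    · exact h
    · exact absurd heq.symm (hφ j i h)
  have := Nat.card_le_card_of_injective φ hinj
  simpa using this

/-- A flexible path template yields many paths with pairwise disjoint variable parts. -/
lemma Flexible.exists_disjoint {V : Type*} {P : Set (ℕ → V)} {t q : ℕ} {g : ℕ → V} {W : Set ℕ}
    (h : Flexible P t (q * t) g W) : ∃ F : ℕ → ℕ → V, ∀ i < q, F i ∈ P ∧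
      (∀ x < t, x ∉ W → F i x = g x) ∧ ∀ j < i, ∀ x < t, x ∈ W → ∀ y < t, F i x ≠ F j y := by
  classical
  suffices ∀ n ≤ q, ∃ F : ℕ → ℕ → V, ∀ i < n, F i ∈ P ∧
      (∀ x < t, x ∉ W → F i x = g x) ∧ ∀ j < i, ∀ x < t, x ∈ W → ∀ y < t, F i x ≠ F j y from
    this q le_rfl
  intro n
  induction n with
  | zero => exact fun _ => ⟨fun _ => g, fun i hi => absurd hi (Nat.not_lt_zero i)⟩
  | succ n ih =>
    intro hn
    obtain ⟨F, hF⟩ := ih (by omega)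
    obtain ⟨f, hf, hfg, hfB⟩ := h ((Finset.range n).biUnion fun i => (Finset.range t).image (F i))
      (by
        refine (Finset.card_biUnion_le_card_mul _ _ t fun i _ => ?_).trans ?_
        · exact Finset.card_image_le.trans_eq (Finset.card_range t)
        · rw [Finset.card_range]
          exact Nat.mul_le_mul_right t (by omega))
    refine ⟨fun i => if i < n then F i else f, fun i hi => ?_⟩
    dsimp only
    split_ifs with hin
    · refine ⟨(hF i hin).1, (hF i hin).2.1, fun j hj => ?_⟩
      rw [if_pos (hj.trans hin)]
      exact (hF i hin).2.2 j hj
    · refine ⟨hf, hfg, fun j hj x hx hxW y hy heq => hfB x hx hxW ?_⟩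
      rw [if_pos (by omega)] at heq
      rw [heq, Finset.mem_biUnion]
      exact ⟨j, Finset.mem_range.2 (by omega),
        Finset.mem_image_of_mem _ (Finset.mem_range.2 hy)⟩

lemma flowerCopy_of_mem {V : Type*} {R : Set V} {q : ℕ} (p : Fin q) {x : V} (h : x ∈ R) :
    flowerCopy R q p x = Sum.inl ⟨x, h⟩ := dif_pos h

lemma flowerCopy_of_notMem {V : Type*} {R : Set V} {q : ℕ} (p : Fin q) {x : V} (h : x ∉ R) :
    flowerCopy R q p x = Sum.inr (⟨x, h⟩, p) := dif_neg h

/-- The kernel is sent to the fixed values of `g`, the petals to the variable parts of `q` disjoint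
alterations. A petal must exist, since injectivity on the kernel is read off an actual path. -/
lemma Flexible.flowerPower_isContained {V : Type*} {G : SimpleGraph V} {t q : ℕ} {g : ℕ → V}
    {W : Set ℕ} (hq : 1 ≤ q) (h : Flexible {f | IsPathOn G t f} t (q * t) g W) :
    (flowerPower (SimpleGraph.pathGraph t) {i : Fin t | (i : ℕ) ∉ W} q).IsContained G := by
  obtain ⟨F, hF⟩ := h.exists_disjoint
  let φ : FlowerVertex {i : Fin t | (i : ℕ) ∉ W} q → V :=
    Sum.elim (fun x => g (x : Fin t)) fun x => F x.2 (x.1 : Fin t)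
  have hφ : ∀ (p : Fin q) (x : Fin t), φ (flowerCopy _ q p x) = F p x := by
    intro p x
    by_cases hx : x ∈ {i : Fin t | (i : ℕ) ∉ W}
    · rw [flowerCopy_of_mem p hx]
      exact ((hF p p.2).2.1 x x.2 hx).symm
    · rw [flowerCopy_of_notMem p hx]
      rfl
  have hinjF : ∀ p : Fin q, ∀ x y : Fin t, F p x = F p y → x = y := fun p x y hxy =>
    Fin.ext ((hF p p.2).1.1 x.2 y.2 hxy)
  have hW : ∀ x : {x : Fin t // x ∉ {i : Fin t | (i : ℕ) ∉ W}}, ((x : Fin t) : ℕ) ∈ W :=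
    fun x => not_not.1 x.2
  have hsymm : ∀ i < q, ∀ j < q, i ≠ j → ∀ x < t, x ∈ W → ∀ y < t, y ∈ W → F i x ≠ F j y := by
    intro i hi j hj hij x hx hxW y hy hyW
    rcases lt_or_gt_of_ne hij with h | h
    · exact ((hF j hj).2.2 i h y hy hyW x hx).symm
    · exact (hF i hi).2.2 j h x hx hxW y hy
  refine ⟨⟨⟨φ, ?_⟩, ?_⟩⟩
  · intro a b hab
    obtain ⟨p, hp⟩ := SimpleGraph.iSup_adj.1 hab
    obtain ⟨-, x, y, hxy, rfl, rfl⟩ := (SimpleGraph.map_adj' _ _ _ _).1 hp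
    rw [hφ, hφ]
    rw [SimpleGraph.pathGraph_adj] at hxy
    rcases hxy with h | h
    · have := (hF p p.2).1.2 x (by omega)
      rwa [h] at this
    · have := (hF p p.2).1.2 y (by omega)
      rw [h] at this
      exact this.symm
  · have hl : ∀ (x : {x : Fin t // x ∈ {i : Fin t | (i : ℕ) ∉ W}}) (p : Fin q),
        φ (Sum.inl x) = F p (x : Fin t) := fun x p => ((hF p p.2).2.1 _ x.1.2 x.2).symm
    rintro (x | ⟨x, p⟩) (y | ⟨y, p'⟩) hxy
    · change φ (Sum.inl x) = φ (Sum.inl y) at hxy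
      rw [hl x ⟨0, hq⟩, hl y ⟨0, hq⟩] at hxy
      rw [Subtype.ext (hinjF _ _ _ hxy)]
    · change φ (Sum.inl x) = φ (Sum.inr (y, p')) at hxy
      rw [hl x p'] at hxy
      have := hinjF p' x.1 y.1 hxy
      exact absurd (this ▸ x.2) y.2
    · change φ (Sum.inr (x, p)) = φ (Sum.inl y) at hxy
      rw [hl y p] at hxy
      have := hinjF p x.1 y.1 hxy
      exact absurd (this ▸ y.2) x.2
    · change F p x.1 = F p' y.1 at hxy
      by_cases hpp : p = p'
      · subst hpp
        rw [Subtype.ext (hinjF p x.1 y.1 hxy)]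
      · exact absurd hxy (hsymm p p.2 p' p'.2 (fun h => hpp (Fin.ext h)) _ x.1.2 (hW x)
          _ y.1.2 (hW y))

/-- A graph that is free of the flower family contains no copy of any flower of the family. -/
lemma not_flowerPower_isContained {V W : Type*} [Finite W] {H : SimpleGraph W} {G : SimpleGraph V}
    {k q : ℕ} (hG : IsFree (flowerFamily H k q) G) {R : Set W} (hR : R ≠ Set.univ)
    (hk : k ≤ Nat.card (H.induce Rᶜ).ConnectedComponent) :
    ¬ (flowerPower H R q).IsContained G := by
  obtain ⟨m, ⟨e⟩⟩ := Finite.exists_equiv_fin (FlowerVertex R q)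
  have iso : (flowerPower H R q).map e.toEmbedding ≃g flowerPower H R q :=
    (SimpleGraph.Iso.map e _).symm
  exact fun h => hG ⟨m, (flowerPower H R q).map e.toEmbedding⟩ ⟨R, hR, hk, ⟨iso⟩⟩
    (((SimpleGraph.isContained_congr_left iso).2) h)

lemma not_flexible_of_isFree {V : Type*} {G : SimpleGraph V} {k t q : ℕ} (hq : 1 ≤ q)
    (hG : IsFree (flowerFamily (SimpleGraph.pathGraph t) (k + 1) q) G) {W : Set ℕ}
    (hW : Alternates k W t) (g : ℕ → V) : ¬ Flexible {f | IsPathOn G t f} t (q * t) g W := by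
  intro h
  refine not_flowerPower_isContained hG (fun hR => ?_) hW.le_card_connectedComponent
    (h.flowerPower_isContained hq)
  have := hW.le_card_connectedComponent
  rw [hR, Set.compl_univ] at this
  simp at this

/-! ### Counting labelled paths: the upper bound. -/

/-- Transfer of flexibility from families of `t`-tuples to families of sequences. -/
lemma FlexibleAt.stable {V : Type*} {t M : ℕ} {H : Finset (Fin t → V)} {U : Finset (Fin t)}
    (h : ∀ f ∈ H, FlexibleAt H M f U) :
    Stable {f : ℕ → V | (fun i : Fin t => f i) ∈ H} t M {x | ∃ i ∈ U, (i : ℕ) = x} := by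
  intro f hf B hB
  obtain ⟨f', hf', h₁, h₂⟩ := h _ hf B hB
  refine ⟨fun i => if hi : i < t then f' ⟨i, hi⟩ else f i, ?_, fun i hi hiU => ?_,
    fun i hi hiU => ?_⟩
  · simpa using hf'
  · dsimp only
    rw [dif_pos hi]
    exact h₁ ⟨i, hi⟩ fun hmem => hiU ⟨_, hmem, rfl⟩
  · dsimp only
    rw [dif_pos hi]
    obtain ⟨j, hj, rfl⟩ := hiU
    exact h₂ j hj

-- A tuple is encoded by `k` oriented edges, with `2 * e(G)` choices each, and one vertex.
open Classical in
lemma card_le_of_edge_transversal {V : Type*} [Fintype V] {G : SimpleGraph V} {t k : ℕ}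
    {H : Finset (Fin t → V)} (hH : ∀ f ∈ H, ∀ i j : Fin t, (i : ℕ) + 1 = j → G.Adj (f i) (f j))
    {p : ℕ → ℕ} {r : ℕ} (hr : r < t) (hp : ∀ j < k, p j + 1 < t)
    (hinj : ∀ f ∈ H, ∀ g ∈ H, (∀ i : Fin t, (i = r ∨ ∃ j < k, i = p j ∨ i = p j + 1) →
      f i = g i) → f = g) :
    H.card ≤ (2 * G.edgeFinset.card) ^ k * Fintype.card V := by
  let φ : (Fin t → V) → (Fin k → V × V) × V := fun f =>
    (fun j => (f ⟨p j, (Nat.lt_succ_self _).trans (hp j j.2)⟩, f ⟨p j + 1, hp j j.2⟩), f ⟨r, hr⟩)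
  have h := Finset.card_le_card_of_injOn (s := H)
    (t := (Fintype.piFinset fun _ => Finset.univ.filter fun x => G.Adj x.1 x.2) ×ˢ Finset.univ) φ
    (fun f hf => by
      simp only [φ, Finset.coe_product, Set.mem_prod, Finset.mem_coe, Fintype.mem_piFinset,
        Finset.mem_filter, Finset.mem_univ, true_and, and_true]
      exact fun j => hH f hf _ _ rfl)
    (fun f hf g hg hfg => hinj f hf g hg fun i hi => by
      obtain ⟨h₁, h₂⟩ := Prod.ext_iff.1 hfg
      rcases hi with hi | ⟨j, hj, hi | hi⟩
      · rwa [show i = ⟨r, hr⟩ from Fin.ext hi]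
      · have := (Prod.ext_iff.1 (congrFun h₁ ⟨j, hj⟩)).1
        rwa [show i = ⟨p j, (Nat.lt_succ_self _).trans (hp j hj)⟩ from Fin.ext hi]
      · have := (Prod.ext_iff.1 (congrFun h₁ ⟨j, hj⟩)).2
        rwa [show i = ⟨p j + 1, hp j hj⟩ from Fin.ext hi])
  rw [Finset.card_product, Fintype.card_piFinset, Finset.prod_const, Finset.card_univ,
    Fintype.card_fin, Finset.card_univ] at h
  have hedge : 2 * G.edgeFinset.card =
      (Finset.univ.filter fun x : V × V => G.Adj x.1 x.2).card :=
    G.two_mul_card_edgeFinset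
  rwa [hedge]

open Classical in
/-- If no path template with more than `k` variable segments is flexible in `G`, then the number
of labelled paths in `G` is `O(e(G) ^ (k - 1) * |V|)`. -/
theorem exists_card_paths_le {k t : ℕ} (hk : 2 ≤ k) (ht : 2 ≤ t) (hdvd : ¬ (k - 1) ∣ (t - 2))
    (N : ℕ) : ∃ C : ℕ, ∀ {V : Type*} [Fintype V] (G : SimpleGraph V),
      (∀ W g, Alternates k W t → ¬ Flexible {f | IsPathOn G t f} t N g W) →
      G.copyCount (SimpleGraph.pathGraph t) ≤
        C * (G.edgeFinset.card ^ (k - 1) * Fintype.card V) := by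
  obtain ⟨C, hC⟩ := exists_homogeneous_subfamily (Fin t) (N + 2 * t)
  refine ⟨C * 2 ^ (k - 1), fun {V} _ G hG => ?_⟩
  obtain ⟨H, hH⟩ : ∃ H : Finset (Fin t → V), H = Finset.univ.image
    fun f : SimpleGraph.Copy (SimpleGraph.pathGraph t) G => (f : Fin t → V) := ⟨_, rfl⟩
  have hcount : G.copyCount (SimpleGraph.pathGraph t) ≤ H.card := by
    rw [hH, Finset.card_image_of_injective _ DFunLike.coe_injective,
      SimpleGraph.copyCount_eq_card_image_copyToSubgraph]
    exact Finset.card_image_le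
  have hHinj : ∀ f ∈ H, Function.Injective f := by
    intro f hf
    rw [hH] at hf
    obtain ⟨c, -, rfl⟩ := Finset.mem_image.1 hf
    exact c.injective
  have hHadj : ∀ f ∈ H, ∀ i j : Fin t, (i : ℕ) + 1 = j → G.Adj (f i) (f j) := by
    intro f hf i j hij
    rw [hH] at hf
    obtain ⟨c, -, rfl⟩ := Finset.mem_image.1 hf
    exact c.toHom.map_adj (SimpleGraph.pathGraph_adj.2 (Or.inl hij))
  obtain ⟨H', hH', hcard, hdich⟩ := hC H
  obtain ⟨P, hPdef⟩ : ∃ P : Set (ℕ → V), P = {f | (fun i : Fin t => f i) ∈ H'} := ⟨_, rfl⟩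
  have hP : ∀ f ∈ P, IsPathOn G t f := by
    intro f hf
    rw [hPdef] at hf
    refine ⟨fun i hi j hj hij => ?_, fun i hi => ?_⟩
    · have := hHinj _ (hH' hf) (a₁ := ⟨i, hi⟩) (a₂ := ⟨j, hj⟩) hij
      exact congrArg Fin.val this
    · exact hHadj _ (hH' hf) ⟨i, by omega⟩ ⟨i + 1, hi⟩ rfl
  rcases H'.eq_empty_or_nonempty with hempty | ⟨f₀, hf₀⟩
  · rw [hempty, Finset.card_empty] at hcard
    omega
  have hPne : P.Nonempty := by
    refine ⟨fun i => if h : i < t then f₀ ⟨i, h⟩ else f₀ ⟨0, by omega⟩, ?_⟩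
    simpa [hPdef] using hf₀
  have halt : ∀ W, Alternates k W t → ∀ g, ¬ Flexible {f | IsPathOn G t f} t N g W :=
    fun W hW g => hG W g hW
  rcases exists_transversal_or_pinned
    (𝒰 := {U | U.Nonempty ∧ (∀ x ∈ U, x < t) ∧ Stable P t (N + 2 * t) U}) hk ht
    (fun U hU U' hU' => ⟨hU.1.mono Set.subset_union_left,
      fun x hx => hx.elim (hU.2.1 x) (hU'.2.1 x), hU.2.2.union hU'.2.2⟩)
    (fun U hU => hU.1) (fun U hU => hU.2.1)
    (fun U hU hUalt => halt U hUalt _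
      ((hU.2.2 _ hPne.some_mem).mono hP le_rfl (Nat.le_add_right _ _)))
    with ⟨p, r, hr, hp, htrans⟩ | ⟨p, hp, hpt, hXY⟩
  · have hbound : H'.card ≤ (2 * G.edgeFinset.card) ^ (k - 1) * Fintype.card V := by
      refine card_le_of_edge_transversal (fun f hf => hHadj f (hH' hf)) hr hp ?_
      -- The positions of the transversal determine the path: the alternative is a nonempty stable
      -- set that avoids them all.
      rcases hdich (Finset.univ.filter fun i : Fin t =>
        (i : ℕ) = r ∨ ∃ j < k - 1, (i : ℕ) = p j ∨ (i : ℕ) = p j + 1) with h | ⟨U, hU, hdisj, hfl⟩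
      · intro f hf g hg hfg
        exact h f hf g hg fun i hi => hfg i (Finset.mem_filter.1 hi).2
      · exfalso
        have hmem := htrans {x | ∃ i ∈ U, (i : ℕ) = x} ⟨?_, ?_, ?_⟩
        · have hnot : ∀ i ∈ U, ¬ ((i : ℕ) = r ∨ ∃ j < k - 1, (i : ℕ) = p j ∨ (i : ℕ) = p j + 1) :=
            fun i hi hcon => Finset.disjoint_left.1 hdisj hi
              (Finset.mem_filter.2 ⟨Finset.mem_univ _, hcon⟩)
          rcases hmem with ⟨i, hi, h⟩ | ⟨j, hj, ⟨i, hi, h⟩ | ⟨i, hi, h⟩⟩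
          · exact hnot i hi (Or.inl h)
          · exact hnot i hi (Or.inr ⟨j, hj, Or.inl h⟩)
          · exact hnot i hi (Or.inr ⟨j, hj, Or.inr h⟩)
        · obtain ⟨i, hi⟩ := hU
          exact ⟨i, i, hi, rfl⟩
        · rintro x ⟨i, -, rfl⟩
          exact i.2
        · rw [hPdef]
          exact FlexibleAt.stable hfl
    calc G.copyCount (SimpleGraph.pathGraph t) ≤ C * H'.card := hcount.trans hcard
      _ ≤ C * ((2 * G.edgeFinset.card) ^ (k - 1) * Fintype.card V) :=
        Nat.mul_le_mul_left _ hbound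
      _ = C * 2 ^ (k - 1) * (G.edgeFinset.card ^ (k - 1) * Fintype.card V) := by
        rw [Nat.mul_pow]
        ring
  · exfalso
    choose! hX hY using hXY
    choose! X hX using hX
    choose! Y hY using hY
    obtain ⟨g, W, hW, hflex⟩ := exists_flexible_of_pinned hk hdvd le_rfl hP hPne hp hpt
      (fun i hi => (hX i hi).1.2.2) (fun i hi => (hY i hi).1.2.2) (fun i hi => (hX i hi).2.1)
      (fun i hi => (hX i hi).2.2.1) (fun i hi => (hX i hi).2.2.2) (fun i hi => (hY i hi).2.1)
      (fun i hi => (hY i hi).2.2.1) (fun i hi => (hY i hi).2.2.2)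
    exact halt W hW g hflex

lemma exists_genTuranNumber_le {k t q : ℕ} (hk : 2 ≤ k) (ht : 2 ≤ t)
    (hdvd : ¬ (k - 1) ∣ (t - 2)) (hq : 1 ≤ q) : ∃ C : ℕ, ∀ ℱ : GraphFamily,
      FreeImpliesFree ℱ (flowerFamily (SimpleGraph.pathGraph t) (k + 1) q) → ∀ n : ℕ,
        genTuranNumber n (SimpleGraph.pathGraph t) ℱ ≤ C * (turanNumber n ℱ ^ (k - 1) * n) := by
  classical
  obtain ⟨C, hC⟩ := exists_card_paths_le hk ht hdvd (q * t)
  refine ⟨C, fun ℱ hℱ n => Finset.sup_le fun G hG => ?_⟩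
  refine (hC G fun W g hW =>
    not_flexible_of_isFree hq (hℱ n G (Finset.mem_filter.1 hG).2) hW g).trans ?_
  rw [Fintype.card_fin]
  refine Nat.mul_le_mul_left _ (Nat.mul_le_mul_right _ (Nat.pow_le_pow_left ?_ _))
  exact (le_of_eq (by congr!)).trans (Finset.le_sup (f := fun G => G.edgeFinset.card) hG)

/-! ### Mixing petals: the lower bound. -/

lemma isFree_of_isContained {ℱ : GraphFamily} {V W : Type*} {G : SimpleGraph V}
    {G' : SimpleGraph W} (hG : IsFree ℱ G) (h : G'.IsContained G) : IsFree ℱ G' :=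
  fun F hF hcon => hG F hF (hcon.trans h)

lemma flowerPower_isContained_of_le {V : Type*} (H : SimpleGraph V) (R : Set V) {q q' : ℕ}
    (h : q ≤ q') : (flowerPower H R q).IsContained (flowerPower H R q') := by
  let φ : FlowerVertex R q → FlowerVertex R q' := Sum.map id (Prod.map id (Fin.castLE h))
  have hinj : Function.Injective φ :=
    Function.injective_id.sumMap (Function.injective_id.prodMap (Fin.castLE_injective h))
  have hφ : ∀ p x, φ (flowerCopy R q p x) = flowerCopy R q' (Fin.castLE h p) x := by
    intro p x
    by_cases hx : x ∈ R
    · rw [flowerCopy_of_mem p hx, flowerCopy_of_mem _ hx]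
      rfl
    · rw [flowerCopy_of_notMem p hx, flowerCopy_of_notMem _ hx]
      rfl
  refine ⟨⟨⟨φ, fun {a b} hab => ?_⟩, hinj⟩⟩
  obtain ⟨p, hp⟩ := SimpleGraph.iSup_adj.1 hab
  obtain ⟨hne, x, y, hxy, rfl, rfl⟩ := (SimpleGraph.map_adj' _ _ _ _).1 hp
  refine SimpleGraph.iSup_adj.2 ⟨Fin.castLE h p, ?_⟩
  rw [hφ, hφ]
  refine SimpleGraph.map_adj_apply' hxy fun hcon => hne (hinj ?_)
  rwa [hφ, hφ]

open Classical in
/-- The vertex map of the copy of `H` in `H_R^q` that uses petal `σ c` for the component `c` of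
`H - R`. -/
noncomputable def mixedCopy {V : Type*} (H : SimpleGraph V) (R : Set V) (q : ℕ)
    (σ : (H.induce Rᶜ).ConnectedComponent → Fin q) (x : V) : FlowerVertex R q :=
  if h : x ∈ R then Sum.inl ⟨x, h⟩
  else Sum.inr (⟨x, h⟩, σ ((H.induce Rᶜ).connectedComponentMk ⟨x, h⟩))

section MixedCopy

variable {V : Type*} {H : SimpleGraph V} {R : Set V} {q : ℕ}
  {σ : (H.induce Rᶜ).ConnectedComponent → Fin q}

lemma mixedCopy_of_mem {x : V} (h : x ∈ R) : mixedCopy H R q σ x = Sum.inl ⟨x, h⟩ := dif_pos h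

lemma mixedCopy_of_notMem {x : V} (h : x ∉ R) : mixedCopy H R q σ x =
    Sum.inr (⟨x, h⟩, σ ((H.induce Rᶜ).connectedComponentMk ⟨x, h⟩)) := dif_neg h

lemma mixedCopy_injective : Function.Injective (mixedCopy H R q σ) := by
  intro x y hxy
  by_cases hx : x ∈ R <;> by_cases hy : y ∈ R
  · rw [mixedCopy_of_mem hx, mixedCopy_of_mem hy] at hxy
    simpa using hxy
  · rw [mixedCopy_of_mem hx, mixedCopy_of_notMem hy] at hxy
    simp at hxy
  · rw [mixedCopy_of_notMem hx, mixedCopy_of_mem hy] at hxy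
    simp at hxy
  · rw [mixedCopy_of_notMem hx, mixedCopy_of_notMem hy] at hxy
    simpa using congrArg Subtype.val (congrArg Prod.fst (Sum.inr_injective hxy))

/-- Adjacent vertices outside `R` share a component, hence a petal, and the vertices of `R` belong
to every petal. So each edge lies in a single copy of `H`. -/
lemma flowerPower_adj_mixedCopy (hq : 1 ≤ q) {x y : V} (hxy : H.Adj x y) :
    (flowerPower H R q).Adj (mixedCopy H R q σ x) (mixedCopy H R q σ y) := by
  have key : ∀ p : Fin q, mixedCopy H R q σ x = flowerCopy R q p x →
      mixedCopy H R q σ y = flowerCopy R q p y →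
      (flowerPower H R q).Adj (mixedCopy H R q σ x) (mixedCopy H R q σ y) := by
    intro p hx hy
    refine SimpleGraph.iSup_adj.2 ⟨p, ?_⟩
    have hne : flowerCopy R q p x ≠ flowerCopy R q p y := by
      rw [← hx, ← hy]
      exact fun h => hxy.ne (mixedCopy_injective h)
    rw [hx, hy]
    exact SimpleGraph.map_adj_apply' hxy hne
  by_cases hx : x ∈ R <;> by_cases hy : y ∈ R
  · exact key ⟨0, hq⟩ (by rw [mixedCopy_of_mem hx, flowerCopy_of_mem _ hx])
      (by rw [mixedCopy_of_mem hy, flowerCopy_of_mem _ hy])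
  · exact key (σ ((H.induce Rᶜ).connectedComponentMk ⟨y, hy⟩))
      (by rw [mixedCopy_of_mem hx, flowerCopy_of_mem _ hx])
      (by rw [mixedCopy_of_notMem hy, flowerCopy_of_notMem _ hy])
  · exact key _ (by rw [mixedCopy_of_notMem hx, flowerCopy_of_notMem _ hx])
      (by rw [mixedCopy_of_mem hy, flowerCopy_of_mem _ hy])
  · have hcomp : (H.induce Rᶜ).connectedComponentMk ⟨x, hx⟩ =
        (H.induce Rᶜ).connectedComponentMk ⟨y, hy⟩ :=
      SimpleGraph.ConnectedComponent.sound
        (SimpleGraph.Adj.reachable (show (H.induce Rᶜ).Adj ⟨x, hx⟩ ⟨y, hy⟩ from hxy))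
    exact key _ (by rw [mixedCopy_of_notMem hx, flowerCopy_of_notMem _ hx])
      (by rw [mixedCopy_of_notMem hy, flowerCopy_of_notMem _ hy, hcomp])

end MixedCopy

/-- A graph that contains `H_R^q` has at least `q ^ c` copies of `H`, where `c` is the number of
components of `H - R`. -/
lemma pow_le_copyCount {V W : Type*} [Finite W] [Fintype V] {H : SimpleGraph W} {R : Set W}
    {q : ℕ} {G : SimpleGraph V} (hq : 1 ≤ q) (h : (flowerPower H R q).IsContained G) :
    q ^ Nat.card (H.induce Rᶜ).ConnectedComponent ≤ G.copyCount H := by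
  classical
  have := Fintype.ofFinite W
  have : Fintype (H.induce Rᶜ).ConnectedComponent := Fintype.ofFinite _
  obtain ⟨c⟩ := h
  let ψ : ((H.induce Rᶜ).ConnectedComponent → Fin q) → SimpleGraph.Copy H G := fun σ =>
    c.comp ⟨⟨mixedCopy H R q σ, flowerPower_adj_mixedCopy hq⟩, mixedCopy_injective⟩
  have hinj : Function.Injective fun σ => (ψ σ).toSubgraph := by
    intro σ τ hστ
    funext comp
    induction comp using SimpleGraph.ConnectedComponent.ind with
    | _ x =>
    obtain ⟨x, hx⟩ := x
    -- The vertex set of the copy already reveals `σ`: only one of the `q` versions of `x` lies in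
    -- it.
    have hmem : c (mixedCopy H R q σ x) ∈ (ψ σ).toSubgraph.verts := by
      rw [SimpleGraph.Subgraph.map_verts]
      exact ⟨x, trivial, rfl⟩
    rw [show (ψ σ).toSubgraph = (ψ τ).toSubgraph from hστ, SimpleGraph.Subgraph.map_verts] at hmem
    obtain ⟨y, -, hy⟩ := hmem
    have hy' : mixedCopy H R q τ y = mixedCopy H R q σ x := c.injective hy
    rw [mixedCopy_of_notMem hx] at hy'
    by_cases hyR : y ∈ R
    · rw [mixedCopy_of_mem hyR] at hy'
      simp at hy'
    · rw [mixedCopy_of_notMem hyR] at hy'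
      obtain ⟨h₁, h₂⟩ := Prod.ext_iff.1 (Sum.inr_injective hy')
      obtain rfl : y = x := congrArg Subtype.val h₁
      exact h₂.symm
  have hcard := Finset.card_le_card_of_injOn (s := Finset.univ)
    (t := (Finset.univ : Finset (SimpleGraph.Copy H G)).image SimpleGraph.Copy.toSubgraph)
    (fun σ => (ψ σ).toSubgraph) (fun σ _ => by simp [-SimpleGraph.Copy.range_toSubgraph])
    (fun σ _ τ _ h => hinj h)
  rw [Finset.card_univ, Fintype.card_fun, Fintype.card_fin] at hcard
  rw [SimpleGraph.copyCount_eq_card_image_copyToSubgraph, Nat.card_eq_fintype_card]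
  exact hcard

lemma card_flowerVertex_le {t : ℕ} (R : Set (Fin t)) {q : ℕ} (hq : 1 ≤ q) :
    Nat.card (FlowerVertex R q) ≤ t * q := by
  classical
  rw [Nat.card_sum, Nat.card_prod, Nat.card_fin]
  have h : Nat.card {x // x ∈ R} + Nat.card {x // x ∉ R} = t := by
    rw [← Nat.card_sum, Nat.card_congr (Equiv.sumCompl fun x => x ∈ R), Nat.card_fin]
  calc Nat.card {x // x ∈ R} + Nat.card {x // x ∉ R} * q
      ≤ Nat.card {x // x ∈ R} * q + Nat.card {x // x ∉ R} * q :=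
        Nat.add_le_add_right (Nat.le_mul_of_pos_right _ hq) _
    _ = t * q := by rw [← Nat.add_mul, h]

/-- From an `ℱ`-free graph with a large flower, an `ℱ`-free graph on `n` vertices with a flower
with `q` petals, provided that the latter has at most `n` vertices. -/
lemma exists_isFree_of_flowerPower {ℱ : GraphFamily} {W : Type*} [Finite W] {H : SimpleGraph W}
    {R : Set W} (hR : R ≠ Set.univ) {q n : ℕ} (hqn : q ≤ n)
    (hcard : Nat.card (FlowerVertex R q) ≤ n) {m : ℕ} {G : SimpleGraph (Fin m)}
    (hG : IsFree ℱ G) (h : (flowerPower H R n).IsContained G) :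
    ∃ G' : SimpleGraph (Fin n), IsFree ℱ G' ∧ (flowerPower H R q).IsContained G' := by
  classical
  have := Fintype.ofFinite W
  obtain ⟨c⟩ := h
  obtain ⟨d⟩ := flowerPower_isContained_of_le H R hqn
  obtain ⟨x₀, hx₀⟩ := (Set.ne_univ_iff_exists_notMem R).1 hR
  -- The small flower occupies `A`, with at most `n` vertices. The large one occupies `B`, with at
  -- least `n`, as each of its `n` petals contains a version of `x₀`. A set of exactly `n` vertices
  -- fits between them.
  obtain ⟨A, hA⟩ : ∃ A : Finset (Fin m), A = Finset.univ.image fun x => c (d x) := ⟨_, rfl⟩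
  obtain ⟨B, hB⟩ : ∃ B : Finset (Fin m), B = Finset.univ.image fun x => c x := ⟨_, rfl⟩
  have hAB : A ⊆ B := by
    rw [hA, hB]
    intro x hx
    obtain ⟨y, -, rfl⟩ := Finset.mem_image.1 hx
    exact Finset.mem_image_of_mem _ (Finset.mem_univ _)
  have hAn : A.card ≤ n := by
    rw [hA]
    refine Finset.card_image_le.trans ?_
    rwa [Finset.card_univ, ← Nat.card_eq_fintype_card]
  have hBn : n ≤ B.card := by
    rw [hB, Finset.card_image_of_injective _ (show Function.Injective fun x => c x from c.injective)]
    have := Fintype.card_le_of_injective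
      (fun p : Fin n => (Sum.inr (⟨x₀, hx₀⟩, p) : FlowerVertex R n)) (fun p p' h => by simpa using h)
    rwa [Fintype.card_fin] at this
  obtain ⟨D, hAD, -, hD⟩ := Finset.exists_subsuperset_card_eq hAB hAn hBn
  let e : Fin n ≃ D := (finCongr hD.symm).trans D.equivFin.symm
  have hemb : (G.comap fun i => (e i : Fin m)).IsContained G :=
    ⟨⟨⟨fun i => (e i : Fin m), fun h => h⟩, Subtype.val_injective.comp e.injective⟩⟩
  refine ⟨_, isFree_of_isContained hG hemb, ⟨⟨⟨fun x => e.symm ⟨c (d x), hAD ?_⟩, ?_⟩, ?_⟩⟩⟩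
  · rw [hA]
    exact Finset.mem_image_of_mem _ (Finset.mem_univ x)
  · intro x y hxy
    simpa using c.toHom.map_adj (d.toHom.map_adj hxy)
  · intro x y hxy
    have := Subtype.ext_iff.1 (e.symm.injective hxy)
    exact d.injective (c.injective this)

/-- The failure is used with `n` petals although only `n / t` are counted: the surplus ensures that
the host graph has `n` vertices to keep. -/
lemma pow_le_genTuranNumber {k t : ℕ} (ht : 1 ≤ t) {ℱ : GraphFamily}
    (hℱ : ¬ ∃ q : ℕ, 1 ≤ q ∧
      FreeImpliesFree ℱ (flowerFamily (SimpleGraph.pathGraph t) (k + 1) q)) {n : ℕ} (hn : t ≤ n) :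
    (n / t) ^ (k + 1) ≤ genTuranNumber n (SimpleGraph.pathGraph t) ℱ := by
  classical
  have hq : 1 ≤ n / t := (Nat.one_le_div_iff (by omega)).2 hn
  have hn' : ¬ FreeImpliesFree ℱ (flowerFamily (SimpleGraph.pathGraph t) (k + 1) n) :=
    fun h => hℱ ⟨n, by omega, h⟩
  simp only [FreeImpliesFree, not_forall] at hn'
  obtain ⟨m, G, hG, hfl⟩ := hn'
  simp only [IsFree, not_forall] at hfl
  obtain ⟨F, ⟨R, hR, hk, ⟨e⟩⟩, hF⟩ := hfl
  have hcont := (SimpleGraph.isContained_congr_left e).1 (not_not.1 hF)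
  obtain ⟨G', hG', hcont'⟩ := exists_isFree_of_flowerPower hR (Nat.div_le_self n t)
    ((card_flowerVertex_le R hq).trans (Nat.mul_div_le n t)) hG hcont
  calc (n / t) ^ (k + 1) ≤ (n / t) ^ Nat.card _ := Nat.pow_le_pow_right hq hk
    _ ≤ G'.copyCount (SimpleGraph.pathGraph t) := pow_le_copyCount hq hcont'
    _ ≤ _ := Finset.le_sup (f := fun G : SimpleGraph (Fin n) =>
        G.copyCount (SimpleGraph.pathGraph t))
        (Finset.mem_filter.2 ⟨Finset.mem_univ _, hG'⟩)

end GenTuran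

/-! ### Assembling the two bounds with explicit constants. -/

theorem theorem1p10 (k t : ℕ) (hk : 3 ≤ k) (ht : 3 ≤ t) (hkt : ¬ t ≡ 2 [MOD (k - 1)]) :
    (∀ q : ℕ, 1 ≤ q → ∃ C : ℝ, 0 < C ∧
      ∀ ℱ : GenTuran.GraphFamily, (∀ F ∈ ℱ, F.2 ≠ ⊥) →
        GenTuran.FreeImpliesFree ℱ
          (GenTuran.flowerFamily (SimpleGraph.pathGraph t) (k + 1) q) →
        ∀ n : ℕ, (GenTuran.genTuranNumber n (SimpleGraph.pathGraph t) ℱ : ℝ) ≤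
          C * ((GenTuran.turanNumber n ℱ : ℝ) ^ (k - 1) * (n : ℝ))) ∧
    (∃ c : ℝ, 0 < c ∧ ∃ N : ℕ,
      ∀ ℱ : GenTuran.GraphFamily, (∀ F ∈ ℱ, F.2 ≠ ⊥) →
        (¬ ∃ q : ℕ, 1 ≤ q ∧ GenTuran.FreeImpliesFree ℱ
          (GenTuran.flowerFamily (SimpleGraph.pathGraph t) (k + 1) q)) →
        ∀ n : ℕ, N ≤ n → c * (n : ℝ) ^ (k + 1) ≤
          (GenTuran.genTuranNumber n (SimpleGraph.pathGraph t) ℱ : ℝ)) := by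
  have hdvd : ¬ (k - 1) ∣ (t - 2) := fun h =>
    hkt ((Nat.modEq_iff_dvd' (by omega)).2 h).symm
  refine ⟨fun q hq => ?_, ?_⟩
  · obtain ⟨C, hC⟩ := GenTuran.exists_genTuranNumber_le (by omega) (by omega) hdvd hq
    -- `C` may be `0`, whereas the constant has to be positive.
    refine ⟨C + 1, by positivity, fun ℱ _ hℱ n => ?_⟩
    have h : (GenTuran.genTuranNumber n (SimpleGraph.pathGraph t) ℱ : ℝ) ≤
        C * ((GenTuran.turanNumber n ℱ : ℝ) ^ (k - 1) * (n : ℝ)) := by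
      exact_mod_cast hC ℱ hℱ n
    refine h.trans ?_
    gcongr
    linarith
  · have ht0 : (0 : ℝ) < t := by exact_mod_cast (by omega : 0 < t)
    -- For `n ≥ t`, rounding down loses at most a factor `2`: the natural quotient `n / t` is at
    -- least the real number `n / (2 * t)`.
    refine ⟨(1 / (2 * t)) ^ (k + 1), by positivity, t, fun ℱ _ hℱ n hn => ?_⟩
    have h : (((n / t : ℕ) : ℝ)) ^ (k + 1) ≤
        (GenTuran.genTuranNumber n (SimpleGraph.pathGraph t) ℱ : ℝ) := by
      exact_mod_cast GenTuran.pow_le_genTuranNumber (by omega) hℱ hn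
    refine le_trans ?_ h
    rw [← mul_pow]
    refine pow_le_pow_left₀ (by positivity) ?_ _
    have h₁ : n ≤ 2 * t * (n / t) := by
      have h₂ := Nat.div_add_mod n t
      have h₃ := Nat.mod_lt n (show 0 < t by omega)
      have h₄ : t * 1 ≤ t * (n / t) :=
        Nat.mul_le_mul_left t ((Nat.one_le_div_iff (by omega)).2 hn)
      rw [Nat.mul_assoc]
      omega
    have h₁' : (n : ℝ) ≤ 2 * t * ((n / t : ℕ) : ℝ) := by exact_mod_cast h₁
    rw [one_div, inv_mul_le_iff₀ (by positivity)]
    exact h₁'
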